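/- Let $K$ be a field. Let $\mathbf{DGVct}$ be the monoidal category of non-negatively graded chain complexes of $K$-vector spaces (differential of degree $-1$, the usual graded tensor product with differential $d(x\otimes y)=dx\otimes y+(-1)^{|x|}x\otimes dy$, unit $K[0]$). A differential graded (DG) coalgebra is a comonoid (counital, coassociative, not necessarily cocommutative) in $\mathbf{DGVct}$; it is connected if $C_0\cong K$. Let $\mathbf{DGcoAlg}_c$ be the category of connected DG coalgebras. In $\mathbf{DGcoAlg}_c$, a map is a weak equivalence if it induces an isomorphism on homology, a cofibration if it is injective in each degree, and a fibration if it has the right lifting property with respect to all maps that are both cofibrations and weak equivalences; an acyclic fibration is a fibration that is a weak equivalence. For a connected DG coalgebra $C$ let $I'_d(C)=C/K[0]$ be its quotient by its degree $0$ part, that is, $I'_d(C)_n=C_n$ for $n\ge 1$ and $I'_d(C)_0=0$. For a complex $V$ in $\mathbf{DGVct}$ with $V_0=0$ let $\mathrm{cone}(V)$ be the mapping cone of $\mathrm{id}_V$, so that $\mathrm{cone}(V)_n=V_{n-1}\oplus V_n$, and let $T'_d(V)=\bigoplus_{n\ge 0}V^{\otimes n}$ be the tensor coalgebra, with the deconcatenation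 comultiplication $v_1\otimes\cdots\otimes v_n\mapsto\sum_{r=0}^{n}(v_1\otimes\cdots\otimes v_r)\otimes(v_{r+1}\otimes\cdots\otimes v_n)$ and the projection onto $V^{\otimes 0}=K$ as counit. **Proposition.** Let $f\colon C\to D$ be a morphism in $\mathbf{DGcoAlg}_c$. Then the categorical product $X=D\sqcap T'_d\big(\mathrm{cone}(I'_d(C))\big)$ exists in $\mathbf{DGcoAlg}_c$, and $f$ factors as $$C\xrightarrow{\;i\;}X\xrightarrow{\;p\;}D,\qquad f=p\circ i,$$ where $p$ is the projection of the product onto $D$, $i$ is a cofibration and $p$ is an acyclic fibration. -/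

import Mathlib

open CategoryTheory MonoidalCategory Limits
universe u

namespace TensorCoalg
noncomputable section
variable {C : Type*} [Category C] [MonoidalCategory C]

/-- The tensor power `V^{⊗ n}`. -/
def tpow (V : C) : ℕ → C
  | 0 => 𝟙_ C
  | n + 1 => tpow V n ⊗ V

/-- The canonical isomorphism `V^{⊗ (p + q)} ⟶ V^{⊗ p} ⊗ V^{⊗ q}` (no permutation of factors). -/
def cutAdd (V : C) (p : ℕ) : (q : ℕ) → (tpow V (p + q) ⟶ tpow V p ⊗ tpow V q)
  | 0 => (ρ_ (tpow V p)).inv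
  | q + 1 => cutAdd V p q ▷ V ≫ (α_ (tpow V p) (tpow V q) V).hom

lemma eqToHom_tpow_succ (V : C) {m n : ℕ} (h : m = n) :
    eqToHom (congrArg (fun k => tpow V (k + 1)) h) = eqToHom (congrArg (tpow V) h) ▷ V := by
  subst h
  exact (id_whiskerRight _ _).symm

lemma cut_left_aux {X Y V : C} {e : X ⟶ Y} {f : Y ⟶ 𝟙_ C ⊗ X} (h : e ≫ f = (λ_ X).inv) :
    e ▷ V ≫ f ▷ V ≫ (α_ (𝟙_ C) X V).hom = (λ_ (X ⊗ V)).inv := by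
  rw [← comp_whiskerRight_assoc, h]
  simp

lemma cut_assoc_aux {X Y A B E G D V : C} {e : X ⟶ Y} {f : Y ⟶ A ⊗ B} {g : B ⟶ G ⊗ D}
    {f' : X ⟶ E ⊗ D} {g' : E ⟶ A ⊗ G}
    (h : e ≫ f ≫ A ◁ g = f' ≫ g' ▷ D ≫ (α_ A G D).hom) :
    e ▷ V ≫ (f ▷ V ≫ (α_ A B V).hom) ≫ A ◁ (g ▷ V ≫ (α_ G D V).hom) =
      (f' ▷ V ≫ (α_ E D V).hom) ≫ g' ▷ (D ⊗ V) ≫ (α_ A G (D ⊗ V)).hom := by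
  have := congrArg (fun f => f ▷ V) h
  simp only [comp_whiskerRight] at this
  simp only [MonoidalCategory.whiskerLeft_comp, Category.assoc]
  rw [← associator_naturality_middle_assoc, reassoc_of% this]
  simp

lemma cutAdd_left_zero (V : C) (n : ℕ) :
    eqToHom (congrArg (tpow V) (Nat.zero_add n).symm) ≫ cutAdd V 0 n =
      (λ_ (tpow V n)).inv := by
  induction n with
  | zero => exact (Category.id_comp _).trans unitors_inv_equal.symm
  | succ n ih =>
    have h := eqToHom_tpow_succ V (Nat.zero_add n).symm
    exact (congrArg (fun f => f ≫ cutAdd V 0 n ▷ V ≫ (α_ _ _ _).hom) h).trans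
      (cut_left_aux ih)

lemma cutAdd_assoc (V : C) (a c d : ℕ) :
    eqToHom (congrArg (tpow V) (Nat.add_assoc a c d)) ≫ cutAdd V a (c + d) ≫
        tpow V a ◁ cutAdd V c d =
      cutAdd V (a + c) d ≫ cutAdd V a c ▷ tpow V d ≫ (α_ _ _ _).hom := by
  induction d with
  | zero =>
    have h : ∀ {X A B : C} (f : X ⟶ A ⊗ B), 𝟙 X ≫ f ≫ A ◁ (ρ_ B).inv =
        (ρ_ X).inv ≫ f ▷ 𝟙_ C ≫ (α_ A B (𝟙_ C)).hom := by
      intro X A B f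
      simp
    exact h (cutAdd V a c)
  | succ d ih =>
    exact (congrArg (fun f => f ≫ (cutAdd V a (c + d) ▷ V ≫ (α_ _ _ _).hom) ≫
      tpow V a ◁ (cutAdd V c d ▷ V ≫ (α_ _ _ _).hom))
      (eqToHom_tpow_succ V (Nat.add_assoc a c d))).trans (cut_assoc_aux ih)

section Cut

variable [Preadditive C]

/-- The map `V^{⊗ n} ⟶ V^{⊗ p} ⊗ V^{⊗ q}` given, when `n = p + q`, by
`v₁ ⊗ ⋯ ⊗ vₙ ↦ (v₁ ⊗ ⋯ ⊗ v_p) ⊗ (v_{p+1} ⊗ ⋯ ⊗ vₙ)`, and zero otherwise. -/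
def cut (V : C) (n p q : ℕ) : tpow V n ⟶ tpow V p ⊗ tpow V q :=
  if h : n = p + q then eqToHom (congrArg (tpow V) h) ≫ cutAdd V p q else 0

lemma cut_add (V : C) (p q : ℕ) : cut V (p + q) p q = cutAdd V p q := by
  simp [cut]

lemma cut_right_zero (V : C) (n : ℕ) : cut V n n 0 = (ρ_ (tpow V n)).inv :=
  cut_add V n 0

lemma cut_left_zero (V : C) (n : ℕ) : cut V n 0 n = (λ_ (tpow V n)).inv := by
  rw [cut, dif_pos (Nat.zero_add n).symm]
  exact cutAdd_left_zero V n

lemma cut_assoc (V : C) {n a c d : ℕ} (h : n = a + c + d) :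
    cut V n a (c + d) ≫ tpow V a ◁ cut V (c + d) c d =
      cut V n (a + c) d ≫ cut V (a + c) a c ▷ tpow V d ≫ (α_ _ _ _).hom := by
  subst h
  rw [cut_add, cut_add, cut_add, cut, dif_pos (Nat.add_assoc a c d), Category.assoc]
  exact cutAdd_assoc V a c d

end Cut

variable [HasColimitsOfShape (Discrete ℕ) C]

/-- The underlying object `⨁_{n ≥ 0} V^{⊗ n}` of the tensor coalgebra. -/
def obj (V : C) : C := ∐ fun n => tpow V n

/-- The inclusion of the summand `V^{⊗ n}`. -/
def ι (V : C) (n : ℕ) : tpow V n ⟶ obj V := Sigma.ι (fun n => tpow V n) n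

/-- The map out of `⨁_{n ≥ 0} V^{⊗ n}` with prescribed restrictions to the summands. -/
def desc {V W : C} (f : ∀ n, tpow V n ⟶ W) : obj V ⟶ W := Sigma.desc f

lemma ι_desc {V W : C} (f : ∀ n, tpow V n ⟶ W) (n : ℕ) : ι V n ≫ desc f = f n :=
  Sigma.ι_desc (f := fun n => tpow V n) f n

lemma ι_desc_assoc {V W Z : C} (f : ∀ n, tpow V n ⟶ W) (n : ℕ) (g : W ⟶ Z) :
    ι V n ≫ desc f ≫ g = f n ≫ g := by
  rw [← Category.assoc, ι_desc]

lemma hom_ext {V W : C} {f g : obj V ⟶ W} (h : ∀ n, ι V n ≫ f = ι V n ≫ g) : f = g :=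
  Sigma.hom_ext _ _ h

variable [Preadditive C]

/-- The counit: the identity on `V^{⊗ 0}`, zero on `V^{⊗ n}` for `n ≥ 1`. -/
def counit (V : C) : obj V ⟶ 𝟙_ C :=
  desc fun n => match n with
    | 0 => 𝟙 (𝟙_ C)
    | _ + 1 => 0

/-- The deconcatenation comultiplication
`v₁ ⊗ ⋯ ⊗ vₙ ↦ ∑_{p + q = n} (v₁ ⊗ ⋯ ⊗ v_p) ⊗ (v_{p+1} ⊗ ⋯ ⊗ vₙ)`. -/
def comul (V : C) : obj V ⟶ obj V ⊗ obj V :=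
  desc fun n => ∑ x ∈ Finset.HasAntidiagonal.antidiagonal n, cut V n x.1 x.2 ≫ (ι V x.1 ⊗ₘ ι V x.2)

lemma ι_zero_counit (V : C) : ι V 0 ≫ counit V = 𝟙 (𝟙_ C) := ι_desc _ 0

lemma ι_counit_of_ne (V : C) {n : ℕ} (h : n ≠ 0) : ι V n ≫ counit V = 0 := by
  cases n with
  | zero => exact absurd rfl h
  | succ n => exact ι_desc _ (n + 1)

lemma sum_antidiagonal_assoc {M : Type*} [AddCommMonoid M] (n : ℕ) (F : ℕ → ℕ → ℕ → M) :
    ∑ x ∈ Finset.HasAntidiagonal.antidiagonal n, ∑ y ∈ Finset.HasAntidiagonal.antidiagonal x.2, F x.1 y.1 y.2 =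
      ∑ x ∈ Finset.HasAntidiagonal.antidiagonal n, ∑ y ∈ Finset.HasAntidiagonal.antidiagonal x.1, F y.1 y.2 x.2 := by
  rw [Finset.sum_sigma', Finset.sum_sigma']
  refine Finset.sum_nbij' (fun z => ⟨(z.1.1 + z.2.1, z.2.2), (z.1.1, z.2.1)⟩)
    (fun z => ⟨(z.2.1, z.2.2 + z.1.2), (z.2.2, z.1.2)⟩) ?_ ?_ ?_ ?_ ?_
  · rintro ⟨⟨a, b⟩, ⟨c, d⟩⟩ h
    simp only [Finset.mem_sigma, Finset.HasAntidiagonal.mem_antidiagonal] at h ⊢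
    exact ⟨by omega, by trivial⟩
  · rintro ⟨⟨a, b⟩, ⟨c, d⟩⟩ h
    simp only [Finset.mem_sigma, Finset.HasAntidiagonal.mem_antidiagonal] at h ⊢
    exact ⟨by omega, by trivial⟩
  · rintro ⟨⟨a, b⟩, ⟨c, d⟩⟩ h
    simp only [Finset.mem_sigma, Finset.HasAntidiagonal.mem_antidiagonal] at h
    obtain ⟨-, rfl⟩ := h
    rfl
  · rintro ⟨⟨a, b⟩, ⟨c, d⟩⟩ h
    simp only [Finset.mem_sigma, Finset.HasAntidiagonal.mem_antidiagonal] at h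
    obtain ⟨-, rfl⟩ := h
    rfl
  · rintro ⟨⟨a, b⟩, ⟨c, d⟩⟩ h
    rfl

variable [MonoidalPreadditive C]

lemma counit_comul (V : C) : comul V ≫ counit V ▷ obj V = (λ_ (obj V)).inv := by
  refine hom_ext fun n => ?_
  rw [comul, ι_desc_assoc, Preadditive.sum_comp, Finset.sum_eq_single (0, n)]
  · dsimp only
    rw [Category.assoc, MonoidalCategory.tensorHom_def', Category.assoc, ← comp_whiskerRight,
      ι_zero_counit, cut_left_zero]
    have h : ∀ {X Y : C} (f : X ⟶ Y),
        (λ_ X).inv ≫ 𝟙_ C ◁ f ≫ 𝟙 (𝟙_ C) ▷ Y = f ≫ (λ_ Y).inv := by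
      intro X Y f
      simp
    exact h (ι V n)
  · rintro ⟨p, q⟩ hpq hne
    rw [Finset.HasAntidiagonal.mem_antidiagonal] at hpq
    have hp : p ≠ 0 := by
      rintro rfl
      exact hne (by simpa using hpq)
    rw [Category.assoc, MonoidalCategory.tensorHom_def', Category.assoc, ← comp_whiskerRight,
      ι_counit_of_ne V hp]
    simp
  · intro h
    exact absurd (by simp) h

lemma comul_counit (V : C) : comul V ≫ obj V ◁ counit V = (ρ_ (obj V)).inv := by
  refine hom_ext fun n => ?_
  rw [comul, ι_desc_assoc, Preadditive.sum_comp, Finset.sum_eq_single (n, 0)]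
  · dsimp only
    rw [Category.assoc, MonoidalCategory.tensorHom_def, Category.assoc,
      ← MonoidalCategory.whiskerLeft_comp, ι_zero_counit, cut_right_zero]
    have h : ∀ {X Y : C} (f : X ⟶ Y),
        (ρ_ X).inv ≫ f ▷ 𝟙_ C ≫ Y ◁ 𝟙 (𝟙_ C) = f ≫ (ρ_ Y).inv := by
      intro X Y f
      simp
    exact h (ι V n)
  · rintro ⟨p, q⟩ hpq hne
    rw [Finset.HasAntidiagonal.mem_antidiagonal] at hpq
    have hq : q ≠ 0 := by
      rintro rfl
      exact hne (by simpa using hpq)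
    rw [Category.assoc, MonoidalCategory.tensorHom_def, Category.assoc,
      ← MonoidalCategory.whiskerLeft_comp, ι_counit_of_ne V hq]
    simp
  · intro h
    exact absurd (by simp) h

lemma comul_assoc (V : C) :
    comul V ≫ obj V ◁ comul V = comul V ≫ comul V ▷ obj V ≫ (α_ _ _ _).hom := by
  refine hom_ext fun n => ?_
  have hL : ι V n ≫ comul V ≫ obj V ◁ comul V =
      ∑ x ∈ Finset.HasAntidiagonal.antidiagonal n, ∑ y ∈ Finset.HasAntidiagonal.antidiagonal x.2,
        (cut V n x.1 (y.1 + y.2) ≫ tpow V x.1 ◁ cut V (y.1 + y.2) y.1 y.2) ≫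
          (ι V x.1 ⊗ₘ (ι V y.1 ⊗ₘ ι V y.2)) := by
    rw [comul, ι_desc_assoc, Preadditive.sum_comp]
    refine Finset.sum_congr rfl ?_
    rintro ⟨a, b⟩ -
    dsimp only
    rw [Category.assoc, ← comul, MonoidalCategory.tensorHom_def, Category.assoc,
      ← MonoidalCategory.whiskerLeft_comp, comul, ι_desc, whiskerLeft_sum]
    simp only [Preadditive.comp_sum]
    refine Finset.sum_congr rfl fun y hy => ?_
    obtain rfl := Finset.HasAntidiagonal.mem_antidiagonal.1 hy
    simp only [MonoidalCategory.tensorHom_def (ι V a), MonoidalCategory.whiskerLeft_comp,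
      Category.assoc, whisker_exchange_assoc]
  have hR : ι V n ≫ comul V ≫ comul V ▷ obj V ≫ (α_ _ _ _).hom =
      ∑ x ∈ Finset.HasAntidiagonal.antidiagonal n, ∑ y ∈ Finset.HasAntidiagonal.antidiagonal x.1,
        (cut V n (y.1 + y.2) x.2 ≫ cut V (y.1 + y.2) y.1 y.2 ▷ tpow V x.2 ≫ (α_ _ _ _).hom) ≫
          (ι V y.1 ⊗ₘ (ι V y.2 ⊗ₘ ι V x.2)) := by
    rw [comul, ι_desc_assoc, Preadditive.sum_comp]
    refine Finset.sum_congr rfl ?_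
    rintro ⟨a, b⟩ -
    dsimp only
    rw [Category.assoc, ← comul, MonoidalCategory.tensorHom_def', Category.assoc,
      ← comp_whiskerRight_assoc, comul, ι_desc, sum_whiskerRight]
    simp only [Preadditive.sum_comp, Preadditive.comp_sum]
    refine Finset.sum_congr rfl fun y hy => ?_
    obtain rfl := Finset.HasAntidiagonal.mem_antidiagonal.1 hy
    simp only [Category.assoc, ← associator_naturality, comp_whiskerRight]
    rw [MonoidalCategory.tensorHom_def' (ι V y.1 ⊗ₘ ι V y.2)]
    simp only [Category.assoc, whisker_exchange_assoc]
  rw [hL, hR, sum_antidiagonal_assoc n (fun a c d =>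
    (cut V n a (c + d) ≫ tpow V a ◁ cut V (c + d) c d) ≫ (ι V a ⊗ₘ (ι V c ⊗ₘ ι V d)))]
  refine Finset.sum_congr rfl fun x hx => Finset.sum_congr rfl fun y hy => ?_
  have hx' := Finset.HasAntidiagonal.mem_antidiagonal.1 hx
  have hy' := Finset.HasAntidiagonal.mem_antidiagonal.1 hy
  rw [cut_assoc V (by omega)]

/-- The tensor coalgebra `T'(V) = ⨁_{n ≥ 0} V^{⊗ n}`. -/
def tensorCoalg (V : C) : Comon C :=
  letI : ComonObj (obj V) :=
    { counit := counit V
      comul := comul V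
      counit_comul := counit_comul V
      comul_counit := comul_counit V
      comul_assoc := comul_assoc V }
  ⟨obj V⟩

end
end TensorCoalg

section DG

variable (K : Type u) [Field K]

/-- Differential graded `K`-vector spaces in non-negative degrees, differential of degree `-1`.
The tensor product is Mathlib's: `(X ⊗ Y)_n = ⨁_{p + q = n} X_p ⊗ Y_q` with differential
`d (x ⊗ y) = d x ⊗ y + (-1)^{|x|} x ⊗ d y`, and unit `K` concentrated in degree `0`. -/
abbrev DGVct : Type (u + 1) := ChainComplex (ModuleCat.{u} K) ℕ

/-- Counital coassociative differential graded coalgebras: comonoids in `DGVct K`. -/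
abbrev DGcoAlg : Type (u + 1) := Comon (DGVct K)

/-- A differential graded vector space `V` is connected if `V_0 = 0`. -/
def DGVct.isConnected : ObjectProperty (DGVct K) := fun V => IsZero (V.X 0)

/-- The category of connected differential graded vector spaces. -/
abbrev DGVctConn : Type (u + 1) := (DGVct.isConnected K).FullSubcategory

/-- A differential graded coalgebra `C` is connected if `C_0 ≅ K`, i.e. `C_0` has dimension one
(the counit then identifies the coalgebra `C_0` with `K`). -/
def DGcoAlg.isConnected : ObjectProperty (DGcoAlg K) :=
  fun C => Nonempty (C.X.X 0 ≅ ModuleCat.of K K)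

/-- The category of connected differential graded coalgebras. -/
abbrev DGcoAlgConn : Type (u + 1) := (DGcoAlg.isConnected K).FullSubcategory

variable {K}

/-- The quotient `V / V_0` of `V` by its degree zero part: `V_n` in degrees `n ≥ 1`, zero in
degree `0`. -/
def DGVct.modDegreeZero (V : DGVct K) : DGVct K where
  X n := match n with
    | 0 => ModuleCat.of K PUnit
    | n + 1 => V.X (n + 1)
  d i j := match i, j with
    | i + 1, j + 1 => V.d (i + 1) (j + 1)
    | 0, _ => 0
    | _ + 1, 0 => 0
  shape i j h := by
    match i, j with
    | i + 1, j + 1 => exact V.shape _ _ h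
    | 0, _ => rfl
    | _ + 1, 0 => rfl
  d_comp_d' i j k _ _ := by
    match i, j, k with
    | i + 1, j + 1, k + 1 => exact V.d_comp_d _ _ _
    | 0, _, _ => exact zero_comp
    | _ + 1, 0, _ => exact zero_comp
    | _ + 1, _ + 1, 0 => exact comp_zero

/-- The functor `I'_d` on objects: `I'_d(C) = C / K[0]`, where `K[0] = C_0` is the degree zero part
of the connected coalgebra `C`. -/
def DGcoAlgConn.reduced (C : DGcoAlgConn K) : DGVctConn K :=
  ⟨DGVct.modDegreeZero C.obj.X, ModuleCat.isZero_of_subsingleton (ModuleCat.of K PUnit)⟩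

/-- The cone of a differential graded vector space: the mapping cone of its identity, with
`cone(V)_n = V_{n-1} ⊕ V_n`. -/
noncomputable def DGVctConn.cone (V : DGVctConn K) : DGVctConn K :=
  ⟨HomologicalComplex.homotopyCofiber (𝟙 V.obj),
    HomologicalComplex.homotopyCofiber.isZero_X (𝟙 V.obj) 0 V.property
      (fun _ h => absurd h (Nat.succ_ne_zero _))⟩

instance DGVct.monoidalPreadditive : MonoidalPreadditive (DGVct K) where
  whiskerLeft_zero {X Y Z} := by
    change HomologicalComplex.mapBifunctorMap _ _ _ _ = 0
    ext1 n
    refine HomologicalComplex.mapBifunctor.hom_ext fun p q h => ?_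
    simp
  zero_whiskerRight {X Y Z} := by
    change HomologicalComplex.mapBifunctorMap _ _ _ _ = 0
    ext1 n
    refine HomologicalComplex.mapBifunctor.hom_ext fun p q h => ?_
    simp
  whiskerLeft_add {X Y Z} f g := by
    change HomologicalComplex.mapBifunctorMap _ _ _ _ =
      HomologicalComplex.mapBifunctorMap _ _ _ _ + HomologicalComplex.mapBifunctorMap _ _ _ _
    ext1 n
    refine HomologicalComplex.mapBifunctor.hom_ext fun p q h => ?_
    simp
  add_whiskerRight {X Y Z} f g := by
    change HomologicalComplex.mapBifunctorMap _ _ _ _ =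
      HomologicalComplex.mapBifunctorMap _ _ _ _ + HomologicalComplex.mapBifunctorMap _ _ _ _
    ext1 n
    refine HomologicalComplex.mapBifunctor.hom_ext fun p q h => ?_
    simp

lemma DGVct.isZero_tensor_X_zero (W V : DGVct K) (hV : IsZero (V.X 0)) :
    IsZero ((W ⊗ V : DGVct K).X 0) := by
  rw [IsZero.iff_id_eq_zero]
  refine HomologicalComplex.mapBifunctor.hom_ext fun p q h => ?_
  have hq : q = 0 := by
    have h' : p + q = 0 := h
    omega
  subst hq
  have hz : IsZero (((curriedTensor (ModuleCat.{u} K)).obj (W.X p)).obj (V.X 0)) :=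
    Functor.map_isZero _ hV
  exact hz.eq_of_src _ _

lemma TensorCoalg.tensorCoalg_isConnected (V : DGVctConn K) :
    DGcoAlg.isConnected K (TensorCoalg.tensorCoalg V.obj) := by
  have h₁ : (TensorCoalg.ι V.obj 0).f 0 ≫ (TensorCoalg.counit V.obj).f 0 = 𝟙 _ := by
    rw [← HomologicalComplex.comp_f, TensorCoalg.ι_zero_counit]
    rfl
  have h₂ : (TensorCoalg.counit V.obj).f 0 ≫ (TensorCoalg.ι V.obj 0).f 0 = 𝟙 _ := by
    have hc := isColimitOfPreserves (HomologicalComplex.eval (ModuleCat.{u} K) _ 0)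
      (coproductIsCoproduct fun n => TensorCoalg.tpow V.obj n)
    refine hc.hom_ext ?_
    rintro ⟨n⟩
    cases n with
    | zero =>
      exact (Category.assoc _ _ _).symm.trans
        ((congrArg (fun g => g ≫ (TensorCoalg.ι V.obj 0).f 0) h₁).trans
          ((Category.id_comp _).trans (Category.comp_id _).symm))
    | succ n =>
      exact (DGVct.isZero_tensor_X_zero (TensorCoalg.tpow V.obj n) V.obj V.property).eq_of_src _ _
  exact ⟨(Iso.mk _ _ h₂ h₁ : (TensorCoalg.obj V.obj).X 0 ≅ (𝟙_ (DGVct K)).X 0) ≪≫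
    HomologicalComplex.singleObjXSelf (ComplexShape.down ℕ) 0 (𝟙_ (ModuleCat.{u} K))⟩

/-- The tensor coalgebra functor `T'_d` on objects. -/
noncomputable def DGVctConn.tensorCoalg (V : DGVctConn K) : DGcoAlgConn K :=
  ⟨TensorCoalg.tensorCoalg V.obj, TensorCoalg.tensorCoalg_isConnected V⟩

variable (K)

/-- Weak equivalences: maps inducing an isomorphism on homology. -/
def DGcoAlgConn.weakEquivalences : MorphismProperty (DGcoAlgConn K) :=
  fun _ _ f => QuasiIso f.hom.hom

/-- Cofibrations: degreewise injections. -/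
def DGcoAlgConn.cofibrations : MorphismProperty (DGcoAlgConn K) :=
  fun _ _ f => ∀ n : ℕ, Function.Injective (f.hom.hom.f n)

/-- Fibrations: maps with the right lifting property with respect to acyclic cofibrations. -/
def DGcoAlgConn.fibrations : MorphismProperty (DGcoAlgConn K) :=
  (DGcoAlgConn.cofibrations K ⊓ DGcoAlgConn.weakEquivalences K).rlp

end DG

/-! If `W` vanishes in degree 0, coalgebra maps `A ⟶ T'(W)` are the same as chain maps `A ⟶ W`
(`exists_tensorCoalg_lift`, `tensorCoalg_comonHom_ext`). A product of `D` and `T'(W)` must therefore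
classify pairs consisting of a coalgebra map to `D` and a chain map to `W`. It is realised
explicitly as `X = ⨁ₙ D ⊗ (W ⊗ D)^{⊗ n}`, whose comultiplication cuts a word inside one of its
letters `D` by applying `Δ[D]` there; `p` is the projection onto the summand `n = 0`. The universal
property is `exists_cofreeProd_lift` and `cofreeProd_comonHom_ext`. Since the `n`-th summand
vanishes below degree `n`, all sums are finite in each degree; `Decomposition` records this.

Now let `W` be the cone of `V = C / C_0`. It is contractible, hence so is every summand of `X` with
`n ≥ 1`, and `p` is a quasi-isomorphism (`Decomposition.quasiIso_π_zero`). A chain map into the cone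
is the same as a family of linear maps into the `V_n`, and over a field such families extend along
injections (`exists_cone_extension`), so `p` lifts against every cofibration. Finally `i` is the map
with components `f` and `C ⟶ C / C_0 ⟶ W`. It is injective in positive degrees because its second
component is, and in degree 0 because it preserves the counit, which is injective on `C_0 ≅ K`
(`counit_f_zero_injective`). -/

noncomputable section

open scoped ComonObj

/-! ### Direct sums of complexes that are finite in each degree. -/

namespace DGVct

variable {K : Type u} [Field K]

lemma sum_f {A B : DGVct K} {α : Type*} (s : Finset α) (F : α → (A ⟶ B)) (m : ℕ) :
    (∑ x ∈ s, F x).f m = ∑ x ∈ s, (F x).f m :=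
  map_sum (HomologicalComplex.Hom.fAddMonoidHom m) F s

/-- Two maps of complexes agree in degrees at most `N`. -/
def AgreeUpTo (N : ℕ) {A B : DGVct K} (f g : A ⟶ B) : Prop :=
  ∀ m ≤ N, f.f m = g.f m

/-- Degree `m` of a tensor product only involves factors of degrees `p + q = m`, both at most `m`.
-/
lemma AgreeUpTo.tensorHom {N : ℕ} {A B A' B' : DGVct K} {f g : A ⟶ B} {f' g' : A' ⟶ B'}
    (h : AgreeUpTo N f g) (h' : AgreeUpTo N f' g') : AgreeUpTo N (f ⊗ₘ f') (g ⊗ₘ g') := by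
  intro m hm
  change (HomologicalComplex.mapBifunctorMap f f' _ _).f m =
    (HomologicalComplex.mapBifunctorMap g g' _ _).f m
  refine HomologicalComplex.mapBifunctor.hom_ext fun p q hpq => ?_
  have hpq' : p + q = m := hpq
  rw [HomologicalComplex.ι_mapBifunctorMap, HomologicalComplex.ι_mapBifunctorMap,
    h p (by omega), h' q (by omega)]

lemma AgreeUpTo.comp_left {N : ℕ} {A B B' : DGVct K} {f g : B ⟶ B'} (h : AgreeUpTo N f g)
    (u : A ⟶ B) : AgreeUpTo N (u ≫ f) (u ≫ g) := fun m hm => by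
  simp [h m hm]

lemma ext_of_agreeUpTo {A B : DGVct K} {f g : A ⟶ B} (h : ∀ N, AgreeUpTo N f g) : f = g := by
  ext1 m
  exact h m m le_rfl

lemma AgreeUpTo.homologyMap_eq {N : ℕ} {A B : DGVct K} {f g : A ⟶ B} (h : AgreeUpTo N f g) :
    HomologicalComplex.homologyMap f N = HomologicalComplex.homologyMap g N := by
  rw [← cancel_epi (A.homologyπ N), HomologicalComplex.homologyπ_naturality,
    HomologicalComplex.homologyπ_naturality]
  congr 1
  rw [← cancel_mono (B.iCycles N), HomologicalComplex.cyclesMap_i,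
    HomologicalComplex.cyclesMap_i, h N le_rfl]

/-- The complex vanishes in degrees below `n`. -/
def ZeroBelow (n : ℕ) (A : DGVct K) : Prop := ∀ m < n, IsZero (A.X m)

lemma ZeroBelow.tensor {n n' : ℕ} {A B : DGVct K} (hA : ZeroBelow n A) (hB : ZeroBelow n' B) :
    ZeroBelow (n + n') (A ⊗ B : DGVct K) := by
  intro m hm
  rw [IsZero.iff_id_eq_zero]
  refine HomologicalComplex.mapBifunctor.hom_ext fun p q h => ?_
  have h' : p + q = m := h
  refine IsZero.eq_of_src ?_ _ _
  by_cases hp : p < n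
  · exact Functor.map_isZero ((curriedTensor (ModuleCat.{u} K)).flip.obj (B.X q)) (hA p hp)
  · exact Functor.map_isZero ((curriedTensor (ModuleCat.{u} K)).obj (A.X p)) (hB q (by omega))

/-- The limit of a sequence of maps of complexes which is eventually constant in each degree. -/
def stableLimit {A B : DGVct K} (F : ℕ → (A ⟶ B))
    (hF : ∀ m N, m ≤ N → (F N).f m = (F m).f m) : A ⟶ B where
  f m := (F m).f m
  comm' i j hij := by
    have h : j + 1 = i := hij
    -- Both degrees are read off the single chain map `F i`.
    rw [← hF j i (by omega), (F i).comm]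

lemma agreeUpTo_stableLimit {A B : DGVct K} (F : ℕ → (A ⟶ B))
    (hF : ∀ m N, m ≤ N → (F N).f m = (F m).f m) (N : ℕ) :
    AgreeUpTo N (stableLimit F hF) (F N) := fun m hm => (hF m N hm).symm

/-- A decomposition of a complex `X` as a direct sum of complexes `Y n`, where `Y n` vanishes in
degrees below `n`. -/
structure Decomposition (X : DGVct K) (Y : ℕ → DGVct K) where
  /-- The projections. -/
  π (n : ℕ) : X ⟶ Y n
  /-- The inclusions. -/
  ι (n : ℕ) : Y n ⟶ X
  ι_π_self (n : ℕ) : ι n ≫ π n = 𝟙 _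
  ι_π_of_ne {n m : ℕ} (h : n ≠ m) : ι n ≫ π m = 0
  zeroBelow (n : ℕ) : ZeroBelow n (Y n)
  agree_sum (N : ℕ) : AgreeUpTo N (∑ n ∈ Finset.range (N + 1), π n ≫ ι n) (𝟙 X)

namespace Decomposition

variable {X : DGVct K} {Y : ℕ → DGVct K} (S : Decomposition X Y)

include S in
lemma hom_ext {A : DGVct K} {f g : A ⟶ X} (h : ∀ n, f ≫ S.π n = g ≫ S.π n) : f = g := by
  refine ext_of_agreeUpTo fun N m hm => ?_
  have h₁ := (S.agree_sum N).comp_left f m hm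
  have h₂ := (S.agree_sum N).comp_left g m hm
  rw [Category.comp_id] at h₁ h₂
  rw [← h₁, ← h₂]
  simp only [Preadditive.comp_sum, reassoc_of% h]

-- Tensoring the finite approximations of the identities of `X` and `X'` approximates the identity
-- of `X ⊗ X'`, so no commutation of `⊗` with infinite coproducts has to be invoked.
include S in
lemma hom_ext₂ {X' : DGVct K} {Y' : ℕ → DGVct K} (S' : Decomposition X' Y')
    {A : DGVct K} {f g : A ⟶ X ⊗ X'}
    (h : ∀ a b, f ≫ (S.π a ⊗ₘ S'.π b) = g ≫ (S.π a ⊗ₘ S'.π b)) : f = g := by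
  refine ext_of_agreeUpTo fun N m hm => ?_
  have h₁ := ((S.agree_sum N).tensorHom (S'.agree_sum N)).comp_left f m hm
  have h₂ := ((S.agree_sum N).tensorHom (S'.agree_sum N)).comp_left g m hm
  rw [id_tensorHom_id, Category.comp_id] at h₁ h₂
  rw [← h₁, ← h₂]
  simp only [Preadditive.comp_sum, tensor_sum, sum_tensor, ← tensorHom_comp_tensorHom,
    reassoc_of% h]

include S in
lemma hom_ext₃ {A : DGVct K} {f g : A ⟶ X ⊗ X ⊗ X}
    (h : ∀ a b c, f ≫ (S.π a ⊗ₘ S.π b ⊗ₘ S.π c) = g ≫ (S.π a ⊗ₘ S.π b ⊗ₘ S.π c)) : f = g := by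
  refine ext_of_agreeUpTo fun N m hm => ?_
  have e := (S.agree_sum N).tensorHom ((S.agree_sum N).tensorHom (S.agree_sum N))
  have h₁ := e.comp_left f m hm
  have h₂ := e.comp_left g m hm
  rw [id_tensorHom_id, id_tensorHom_id, Category.comp_id] at h₁ h₂
  rw [← h₁, ← h₂]
  simp only [Preadditive.comp_sum, tensor_sum, sum_tensor, ← tensorHom_comp_tensorHom,
    reassoc_of% h]

/-- The map into `X` with prescribed components. -/
def lift {A : DGVct K} (f : ∀ n, A ⟶ Y n) : A ⟶ X :=
  stableLimit (fun N => ∑ n ∈ Finset.range (N + 1), f n ≫ S.ι n) (by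
    intro m N hm
    simp only [sum_f]
    refine (Finset.sum_subset (Finset.range_mono (by omega)) fun n _ hn => ?_).symm
    rw [HomologicalComplex.comp_f,
      (S.zeroBelow n m (by simpa using hn)).eq_of_tgt ((f n).f m) 0, zero_comp])

lemma sum_ι_π {A : DGVct K} (f : ∀ n, A ⟶ Y n) {n : ℕ} {s : Finset ℕ} (hn : n ∈ s) :
    (∑ k ∈ s, f k ≫ S.ι k) ≫ S.π n = f n := by
  rw [Preadditive.sum_comp, Finset.sum_eq_single n]
  · simp [S.ι_π_self]
  · intro k _ hk
    simp [S.ι_π_of_ne hk]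
  · exact fun h => absurd hn h

lemma lift_π {A : DGVct K} (f : ∀ n, A ⟶ Y n) (n : ℕ) : S.lift f ≫ S.π n = f n := by
  refine ext_of_agreeUpTo fun N m hm => ?_
  -- The truncation must reach both the degree, for agreement with the limit, and the index `n`, to
  -- contain the relevant summand.
  rw [HomologicalComplex.comp_f, lift, agreeUpTo_stableLimit _ _ (max N n) m (by omega),
    ← HomologicalComplex.comp_f, S.sum_ι_π f (by simp)]

/-- The map into `X ⊗ X` with prescribed components. -/
def lift₂ {A : DGVct K} (f : ∀ a b, A ⟶ Y a ⊗ Y b) : A ⟶ X ⊗ X :=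
  stableLimit (fun N => ∑ x ∈ Finset.range (N + 1) ×ˢ Finset.range (N + 1),
      f x.1 x.2 ≫ (S.ι x.1 ⊗ₘ S.ι x.2)) (by
    intro m N hm
    simp only [sum_f]
    refine (Finset.sum_subset (Finset.product_subset_product (Finset.range_mono (by omega))
      (Finset.range_mono (by omega))) fun x _ hx => ?_).symm
    -- A pair outside the square has a coordinate above `m`, so its summand vanishes in degree `m`.
    rw [HomologicalComplex.comp_f, (((S.zeroBelow x.1).tensor (S.zeroBelow x.2)) m
      (by simp at hx; omega)).eq_of_tgt ((f x.1 x.2).f m) 0, zero_comp])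

lemma lift₂_π {A : DGVct K} (f : ∀ a b, A ⟶ Y a ⊗ Y b) (a b : ℕ) :
    S.lift₂ f ≫ (S.π a ⊗ₘ S.π b) = f a b := by
  refine ext_of_agreeUpTo fun N m hm => ?_
  rw [HomologicalComplex.comp_f, lift₂, agreeUpTo_stableLimit _ _ (max N (max a b)) m (by omega),
    ← HomologicalComplex.comp_f, Preadditive.sum_comp, Finset.sum_eq_single (a, b)]
  · simp [tensorHom_comp_tensorHom, S.ι_π_self]
  · rintro ⟨a', b'⟩ _ h
    rw [Category.assoc, tensorHom_comp_tensorHom]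
    by_cases ha : a' = a
    · have hb : b' ≠ b := by rintro rfl; exact h (by rw [ha])
      simp [S.ι_π_of_ne hb]
    · simp [S.ι_π_of_ne ha]
  · intro h
    exact absurd (by simp) h

/-- The decomposition of a coproduct of complexes `Y n` vanishing in degrees below `n`. -/
def sigma (Y : ℕ → DGVct K) (hY : ∀ n, ZeroBelow n (Y n)) : Decomposition (∐ Y) Y where
  π n := Sigma.desc fun k => if h : k = n then eqToHom (congrArg Y h) else 0
  ι n := Sigma.ι Y n
  ι_π_self n := by simp
  ι_π_of_ne h := by simp [h]
  zeroBelow := hY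
  agree_sum N m hm := by
    have hc := isColimitOfPreserves (HomologicalComplex.eval (ModuleCat.{u} K) _ m)
      (coproductIsCoproduct Y)
    refine hc.hom_ext ?_
    rintro ⟨n⟩
    change (Sigma.ι Y n).f m ≫ _ = (Sigma.ι Y n).f m ≫ _
    by_cases hn : n ≤ N
    · rw [← HomologicalComplex.comp_f, ← HomologicalComplex.comp_f, Preadditive.comp_sum,
        Finset.sum_eq_single n]
      · simp
      · intro k _ hk
        simp [hk.symm]
      · intro h
        exact absurd (by simp; omega) h
    · exact (hY n m (by omega)).eq_of_src _ _

/-- Homology of a decomposition all of whose pieces but the first are contractible. -/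
lemma quasiIso_π_zero (h : ∀ n, Nonempty (Homotopy (𝟙 (Y (n + 1))) 0)) : QuasiIso (S.π 0) := by
  refine ⟨fun m => ?_⟩
  rw [quasiIsoAt_iff_isIso_homologyMap]
  refine ⟨HomologicalComplex.homologyMap (S.ι 0) m, ?_, ?_⟩
  · have e := (S.agree_sum m).homologyMap_eq
    rw [← HomologicalComplex.homologyFunctor_map, Functor.map_sum, Finset.sum_range_succ',
      Finset.sum_eq_zero, zero_add] at e
    · rw [← HomologicalComplex.homologyMap_comp, ← HomologicalComplex.homologyMap_id]
      exact e
    · intro n _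
      obtain ⟨H⟩ := h n
      have hz : HomologicalComplex.homologyMap (𝟙 (Y (n + 1))) m = 0 := by
        rw [H.homologyMap_eq, HomologicalComplex.homologyMap_zero]
      rw [HomologicalComplex.homologyFunctor_map, ← Category.id_comp (S.ι (n + 1)),
        HomologicalComplex.homologyMap_comp, HomologicalComplex.homologyMap_comp, hz, zero_comp,
        comp_zero]
      rfl
  · rw [← HomologicalComplex.homologyMap_comp, S.ι_π_self, HomologicalComplex.homologyMap_id]

end Decomposition
end DGVct

/-! ### Coalgebras decomposed compatibly with cutting. -/

/-- The inductive step, by coassociativity, for checking that recursively defined components respect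
cuts. It serves both the tensor coalgebra and the product. -/
lemma ComonObj.comul_tensorHom_step {C : Type*} [Category C] [MonoidalCategory C]
    {A P Q R M : C} [ComonObj A] {f : A ⟶ Q} {c : Q ⟶ P ⊗ R} {f₁ : A ⟶ P} {f₂ : A ⟶ R}
    (h : f ≫ c = Δ ≫ (f₁ ⊗ₘ f₂)) (k : A ⟶ M) :
    (Δ ≫ (f ⊗ₘ k)) ≫ c ▷ M ≫ (α_ P R M).hom = Δ ≫ (f₁ ⊗ₘ (Δ ≫ (f₂ ⊗ₘ k))) := by
  have h₁ : (f ⊗ₘ k) ≫ c ▷ M = Δ ▷ A ≫ ((f₁ ⊗ₘ f₂) ⊗ₘ k) := by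
    rw [MonoidalCategory.tensorHom_def, MonoidalCategory.tensorHom_def, Category.assoc, whisker_exchange, ← comp_whiskerRight_assoc,
      h, comp_whiskerRight_assoc]
  rw [Category.assoc, reassoc_of% h₁, associator_naturality, ← ComonObj.comul_assoc_assoc]
  simp [MonoidalCategory.tensorHom_def']

namespace DGVct

variable {K : Type u} [Field K]

/-- A decomposition of a DG coalgebra `X` as a direct sum of complexes `Y n`, such that the
components of the comultiplication on `Y n` go to the `Y a ⊗ Y b` with `a + b = n` and the counit
factors through `Y 0`. -/
structure CutDecomposition (X : DGVct K) [ComonObj X] (Y : ℕ → DGVct K) extends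
    Decomposition X Y where
  /-- The components of the comultiplication. -/
  cut (a b : ℕ) : Y (a + b) ⟶ Y a ⊗ Y b
  /-- The restriction of the counit. -/
  counit₀ : Y 0 ⟶ 𝟙_ (DGVct K)
  comul_π (a b : ℕ) : Δ[X] ≫ (π a ⊗ₘ π b) = π (a + b) ≫ cut a b
  π_counit : π 0 ≫ counit₀ = ε[X]

namespace CutDecomposition

variable {X : DGVct K} [ComonObj X] {Y : ℕ → DGVct K} (S : CutDecomposition X Y)

lemma isComonHom_lift {A : DGVct K} [ComonObj A] (f : ∀ n, A ⟶ Y n)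
    (h₀ : f 0 ≫ S.counit₀ = ε) (h : ∀ a b, f (a + b) ≫ S.cut a b = Δ ≫ (f a ⊗ₘ f b)) :
    IsComonHom (S.lift f) where
  hom_counit := by rw [← S.π_counit, ← Category.assoc, S.lift_π, h₀]
  hom_comul := by
    refine S.hom_ext₂ S.toDecomposition fun a b => ?_
    rw [Category.assoc, S.comul_π, ← Category.assoc, S.lift_π, h, Category.assoc,
      tensorHom_comp_tensorHom, S.lift_π, S.lift_π]

/-- Induction on the index: the `(n, 1)` component of the comultiplication expresses component `n +
1` of a coalgebra map through component `n` and the part of component 1 seen by `κ`, and `hκ` says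
that nothing is lost. -/
lemma comonHom_ext {A M : DGVct K} [ComonObj A] (κ : Y 1 ⟶ M)
    (hκ : ∀ n, Mono (S.cut n 1 ≫ Y n ◁ κ)) {φ ψ : A ⟶ X} [IsComonHom φ] [IsComonHom ψ]
    (h₀ : φ ≫ S.π 0 = ψ ≫ S.π 0) (h₁ : φ ≫ S.π 1 ≫ κ = ψ ≫ S.π 1 ≫ κ) : φ = ψ := by
  refine S.hom_ext fun n => ?_
  induction n with
  | zero => exact h₀
  | succ n ih =>
    have e : ∀ (θ : A ⟶ X) [IsComonHom θ], (θ ≫ S.π (n + 1)) ≫ S.cut n 1 ≫ Y n ◁ κ =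
        Δ ≫ ((θ ≫ S.π n) ⊗ₘ (θ ≫ S.π 1 ≫ κ)) := by
      intro θ _
      rw [Category.assoc, ← Category.assoc (S.π (n + 1)), ← S.comul_π, Category.assoc,
        IsComonHom.hom_comul_assoc, ← tensorHom_comp_tensorHom, ← id_tensorHom,
        tensorHom_comp_tensorHom, Category.comp_id]
    have := hκ n
    rw [← cancel_mono (S.cut n 1 ≫ Y n ◁ κ), e φ, e ψ, ih, h₁]

end CutDecomposition

/-! ### Cofreeness of the tensor coalgebra. -/

section TensorCoalgebra

open TensorCoalg

lemma tpow_zeroBelow {V : DGVct K} (hV : IsZero (V.X 0)) (n : ℕ) : ZeroBelow n (tpow V n) := by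
  induction n with
  | zero => exact fun m hm => absurd hm (Nat.not_lt_zero m)
  | succ n ih =>
    refine ih.tensor fun m hm => ?_
    obtain rfl : m = 0 := by omega
    exact hV

/-- The decomposition of the complex underlying the tensor coalgebra into tensor powers. -/
def tensorObjDecomposition {V : DGVct K} (hV : IsZero (V.X 0)) :
    Decomposition (TensorCoalg.obj V) (tpow V) :=
  Decomposition.sigma (tpow V) (tpow_zeroBelow hV)

lemma ι_tensorObjDecomposition_π_self {V : DGVct K} (hV : IsZero (V.X 0)) (n : ℕ) :
    TensorCoalg.ι V n ≫ (tensorObjDecomposition hV).π n = 𝟙 (tpow V n) :=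
  (tensorObjDecomposition hV).ι_π_self n

lemma ι_tensorObjDecomposition_π_of_ne {V : DGVct K} (hV : IsZero (V.X 0)) {n m : ℕ}
    (h : n ≠ m) : TensorCoalg.ι V n ≫ (tensorObjDecomposition hV).π m = 0 :=
  (tensorObjDecomposition hV).ι_π_of_ne h

/-- The components of the comultiplication of the tensor coalgebra. -/
lemma tensorCoalg_comul_π {V : DGVct K} (hV : IsZero (V.X 0)) (a b : ℕ) :
    comul V ≫ ((tensorObjDecomposition hV).π a ⊗ₘ (tensorObjDecomposition hV).π b) =
      (tensorObjDecomposition hV).π (a + b) ≫ cutAdd V a b := by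
  refine hom_ext fun n => ?_
  rw [comul, ι_desc_assoc, Preadditive.sum_comp]
  have hzero : ∀ x : ℕ × ℕ, x ≠ (a, b) → (TensorCoalg.ι V x.1 ⊗ₘ TensorCoalg.ι V x.2) ≫
      ((tensorObjDecomposition hV).π a ⊗ₘ (tensorObjDecomposition hV).π b) = 0 := by
    rintro ⟨a', b'⟩ hne
    rw [tensorHom_comp_tensorHom]
    by_cases ha : a' = a
    · have hb : b' ≠ b := by rintro rfl; exact hne (by rw [ha])
      simp [ι_tensorObjDecomposition_π_of_ne hV hb]
    · simp [ι_tensorObjDecomposition_π_of_ne hV ha]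
  by_cases hn : n = a + b
  · subst hn
    rw [Finset.sum_eq_single (a, b)]
    · rw [Category.assoc, tensorHom_comp_tensorHom, ι_tensorObjDecomposition_π_self,
        ι_tensorObjDecomposition_π_self, ← Category.assoc, ι_tensorObjDecomposition_π_self,
        cut_add]
      simp
    · intro x _ hne
      rw [Category.assoc, hzero x hne, comp_zero]
    · intro h
      exact absurd (by simp) h
  · rw [← Category.assoc, ι_tensorObjDecomposition_π_of_ne hV hn, zero_comp]
    refine Finset.sum_eq_zero fun x hx => ?_
    rw [Finset.HasAntidiagonal.mem_antidiagonal] at hx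
    rw [Category.assoc, hzero x (by rintro rfl; exact hn hx.symm), comp_zero]

lemma tensorObjDecomposition_π_zero {V : DGVct K} (hV : IsZero (V.X 0)) :
    (tensorObjDecomposition hV).π 0 = counit V := by
  refine hom_ext fun n => ?_
  by_cases hn : n = 0
  · subst hn
    exact (ι_tensorObjDecomposition_π_self hV 0).trans (ι_zero_counit V).symm
  · exact (ι_tensorObjDecomposition_π_of_ne hV hn).trans (ι_counit_of_ne V hn).symm

/-- The decomposition of the tensor coalgebra into tensor powers. -/
def tensorCoalgDecomposition {V : DGVct K} (hV : IsZero (V.X 0)) :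
    CutDecomposition (tensorCoalg V).X (tpow V) where
  toDecomposition := tensorObjDecomposition hV
  cut := cutAdd V
  counit₀ := 𝟙 _
  comul_π := tensorCoalg_comul_π hV
  π_counit := (Category.comp_id _).trans (tensorObjDecomposition_π_zero hV)

/-- The projection of the tensor coalgebra onto `V`. -/
def tensorCoalgProj {V : DGVct K} (hV : IsZero (V.X 0)) : (tensorCoalg V).X ⟶ V :=
  (tensorCoalgDecomposition hV).π 1 ≫ (λ_ V).hom

/-- The components of the map to the tensor coalgebra induced by a map of complexes. -/
def tensorCoalgComponent {V A : DGVct K} [ComonObj A] (h : A ⟶ V) : ∀ n, A ⟶ tpow V n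
  | 0 => ε
  | n + 1 => Δ ≫ (tensorCoalgComponent h n ⊗ₘ h)

lemma tensorCoalgComponent_cutAdd {V A : DGVct K} [ComonObj A] (h : A ⟶ V) (a b : ℕ) :
    tensorCoalgComponent h (a + b) ≫ cutAdd V a b =
      Δ ≫ (tensorCoalgComponent h a ⊗ₘ tensorCoalgComponent h b) := by
  induction b with
  | zero => exact (ComonObj.comul_counit_hom _).symm
  | succ b ih => exact ComonObj.comul_tensorHom_step ih h

/-- The components are iterated comultiplications followed by `h^{⊗ n}`. They assemble because `V^{⊗
n}` vanishes below degree `n`, so no conilpotency of `A` is needed. -/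
lemma exists_tensorCoalg_lift {V A : DGVct K} [ComonObj A] (hV : IsZero (V.X 0)) (h : A ⟶ V) :
    ∃ φ : A ⟶ (tensorCoalg V).X, IsComonHom φ ∧ φ ≫ tensorCoalgProj hV = h := by
  let S := tensorCoalgDecomposition hV
  refine ⟨S.lift (tensorCoalgComponent h), S.isComonHom_lift _ (Category.comp_id _)
    (tensorCoalgComponent_cutAdd h), ?_⟩
  have h₁ : S.lift (tensorCoalgComponent h) ≫ S.π 1 = Δ ≫ (ε ⊗ₘ h) :=
    S.lift_π (tensorCoalgComponent h) 1
  have h₂ : (Δ ≫ (ε ⊗ₘ h)) ≫ (λ_ V).hom = h := by simp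
  exact (Category.assoc _ _ _).symm.trans ((congrArg (fun x => x ≫ (λ_ V).hom) h₁).trans h₂)

lemma tensorCoalg_comonHom_ext {V A : DGVct K} [ComonObj A] (hV : IsZero (V.X 0))
    {φ ψ : A ⟶ (tensorCoalg V).X} (hφ : IsComonHom φ) (hψ : IsComonHom ψ)
    (h : φ ≫ tensorCoalgProj hV = ψ ≫ tensorCoalgProj hV) : φ = ψ := by
  let S := tensorCoalgDecomposition hV
  refine S.comonHom_ext (M := V) (λ_ V).hom (fun n => ?_) ?_ h
  -- Cutting off the last letter is an isomorphism up to unitors, which gives the required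
  -- monomorphism.
  · have : ((ρ_ (tpow V n)).inv ▷ V ≫ (α_ _ _ V).hom) ≫ tpow V n ◁ (λ_ V).hom = 𝟙 _ := by simp
    change Mono (((ρ_ (tpow V n)).inv ▷ V ≫ (α_ _ _ V).hom) ≫ tpow V n ◁ (λ_ V).hom)
    rw [this]
    infer_instance
  · have e : ∀ (θ : A ⟶ (tensorCoalg V).X) [IsComonHom θ], θ ≫ S.π 0 = ε[A] := by
      intro θ _
      have h₁ : S.π 0 ≫ 𝟙 _ = ε[(tensorCoalg V).X] := S.π_counit
      have h₂ : S.π 0 = ε[(tensorCoalg V).X] := (Category.comp_id _).symm.trans h₁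
      exact (congrArg (fun x => θ ≫ x) h₂).trans (IsComonHom.hom_counit θ)
    rw [e φ, e ψ]

end TensorCoalgebra
end DGVct

/-! ### Cuts and coactions on alternating words in `D` and `W`. -/

namespace DGVct

section Cut

variable {C : Type*} [Category C] [MonoidalCategory C] (D W : C)

/-- The summand `D ⊗ (W ⊗ D)^{⊗ n}` of the product of `D` and the tensor coalgebra on `W`. -/
def altPow : ℕ → C
  | 0 => D
  | n + 1 => altPow n ⊗ (W ⊗ D)

lemma eqToHom_altPow_succ {m n : ℕ} (h : m = n) :
    eqToHom (congrArg (fun k => altPow D W (k + 1)) h) =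
      eqToHom (congrArg (altPow D W) h) ▷ (W ⊗ D) := by
  subst h
  exact (id_whiskerRight _ _).symm

variable [ComonObj D]

/-- The right coaction of `D` on `W ⊗ D`. -/
def cofreeCoact : W ⊗ D ⟶ (W ⊗ D) ⊗ D := W ◁ Δ[D] ≫ (α_ W D D).inv

lemma cofreeCoact_assoc : cofreeCoact D W ≫ (W ⊗ D) ◁ Δ[D] =
    cofreeCoact D W ≫ cofreeCoact D W ▷ D ≫ (α_ (W ⊗ D) D D).hom := by
  have h := congrArg (fun f => W ◁ f) (ComonObj.comul_assoc D)
  simp only [MonoidalCategory.whiskerLeft_comp] at h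
  rw [cofreeCoact, Category.assoc, ← cancel_mono (α_ (W ⊗ D) D D).inv,
    ← cancel_mono ((α_ W D D).hom ▷ D), ← cancel_mono (α_ W (D ⊗ D) D).hom,
    ← cancel_mono (W ◁ (α_ D D D).hom)]
  simp [h]

lemma cofreeCoact_counit : cofreeCoact D W ≫ (W ⊗ D) ◁ ε[D] = (ρ_ (W ⊗ D)).inv := by
  have h := congrArg (fun f => W ◁ f) (ComonObj.comul_counit D)
  simp only [MonoidalCategory.whiskerLeft_comp] at h
  rw [cofreeCoact, Category.assoc, ← cancel_mono (α_ W D (𝟙_ C)).hom]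
  simp [h]

/-- The right coaction of `D` on `D ⊗ (W ⊗ D)^{⊗ n}`. -/
def altCoact : ∀ n, altPow D W n ⟶ altPow D W n ⊗ D
  | 0 => Δ[D]
  | n + 1 => altPow D W n ◁ cofreeCoact D W ≫ (α_ (altPow D W n) (W ⊗ D) D).inv

/-- The map `D ⊗ (W ⊗ D)^{⊗ (p + q)} ⟶ (D ⊗ (W ⊗ D)^{⊗ p}) ⊗ (D ⊗ (W ⊗ D)^{⊗ q})` which
applies the comultiplication to the `p`-th copy of `D`. -/
def altCut (p : ℕ) : ∀ q, altPow D W (p + q) ⟶ altPow D W p ⊗ altPow D W q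
  | 0 => altCoact D W p
  | q + 1 => altCut p q ▷ (W ⊗ D) ≫ (α_ (altPow D W p) (altPow D W q) (W ⊗ D)).hom

lemma whiskerLeft_coact_assoc {P M D' : C} {δ : D' ⟶ D' ⊗ D'} {r : M ⟶ M ⊗ D'}
    (h : r ≫ M ◁ δ = r ≫ r ▷ D' ≫ (α_ M D' D').hom) :
    (P ◁ r ≫ (α_ P M D').inv) ≫ (P ⊗ M) ◁ δ =
      (P ◁ r ≫ (α_ P M D').inv) ≫ (P ◁ r ≫ (α_ P M D').inv) ▷ D' ≫ (α_ (P ⊗ M) D' D').hom := by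
  have h' := congrArg (fun f => P ◁ f) h
  simp only [MonoidalCategory.whiskerLeft_comp] at h'
  rw [← cancel_mono (α_ P M (D' ⊗ D')).hom]
  simp [h']

lemma whiskerLeft_coact_counit {P M D' : C} {e : D' ⟶ 𝟙_ C} {r : M ⟶ M ⊗ D'}
    (h : r ≫ M ◁ e = (ρ_ M).inv) :
    (P ◁ r ≫ (α_ P M D').inv) ≫ (P ⊗ M) ◁ e = (ρ_ (P ⊗ M)).inv := by
  have h' := congrArg (fun f => P ◁ f) h
  simp only [MonoidalCategory.whiskerLeft_comp] at h'
  rw [← cancel_mono (α_ P M (𝟙_ C)).hom]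
  simp [h']

lemma altCoact_assoc (n : ℕ) : altCoact D W n ≫ altPow D W n ◁ Δ[D] =
    altCoact D W n ≫ altCoact D W n ▷ D ≫ (α_ (altPow D W n) D D).hom := by
  cases n with
  | zero => exact ComonObj.comul_assoc D
  | succ n => exact whiskerLeft_coact_assoc (cofreeCoact_assoc D W)

lemma altCoact_counit (n : ℕ) :
    altCoact D W n ≫ altPow D W n ◁ ε[D] = (ρ_ (altPow D W n)).inv := by
  cases n with
  | zero => exact ComonObj.comul_counit D
  | succ n => exact whiskerLeft_coact_counit (cofreeCoact_counit D W)

lemma cut_coact_aux {Q A B M D' : C} {c : Q ⟶ A ⊗ B} {r : M ⟶ M ⊗ D'} :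
    (c ▷ M ≫ (α_ A B M).hom) ≫ A ◁ (B ◁ r ≫ (α_ B M D').inv) =
      (Q ◁ r ≫ (α_ Q M D').inv) ≫ (c ▷ M ≫ (α_ A B M).hom) ▷ D' ≫ (α_ A (B ⊗ M) D').hom := by
  rw [← cancel_mono (A ◁ (α_ B M D').hom)]
  have h : (c ▷ M ≫ (α_ A B M).hom) ≫ A ◁ B ◁ r = Q ◁ r ≫ c ▷ (M ⊗ D') ≫ (α_ A B (M ⊗ D')).hom := by
    rw [Category.assoc, ← associator_naturality_right, whisker_exchange_assoc]
  simpa using h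

/-- For `c = 0` the same letter `D` is split twice, which is coassociativity of the coaction; for `c
> 0` two different letters are split, and these operations commute. -/
lemma altCut_coact (a c : ℕ) : altCut D W a c ≫ altPow D W a ◁ altCoact D W c =
    altCoact D W (a + c) ≫ altCut D W a c ▷ D ≫ (α_ (altPow D W a) (altPow D W c) D).hom := by
  cases c with
  | zero => exact altCoact_assoc D W a
  | succ c => exact cut_coact_aux

/-- Only the base case involves `Δ[D]`. Adjoining a letter `W ⊗ D` on the right is formal, exactly
as for the tensor coalgebra. -/
lemma altCut_assoc (a c d : ℕ) :
    eqToHom (congrArg (altPow D W) (Nat.add_assoc a c d)) ≫ altCut D W a (c + d) ≫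
        altPow D W a ◁ altCut D W c d =
      altCut D W (a + c) d ≫ altCut D W a c ▷ altPow D W d ≫ (α_ _ _ _).hom := by
  induction d with
  | zero => exact (Category.id_comp _).trans (altCut_coact D W a c)
  | succ d ih =>
    exact (congrArg (fun f => f ≫ (altCut D W a (c + d) ▷ (W ⊗ D) ≫ (α_ _ _ _).hom) ≫
      altPow D W a ◁ (altCut D W c d ▷ (W ⊗ D) ≫ (α_ _ _ _).hom))
      (eqToHom_altPow_succ D W (Nat.add_assoc a c d))).trans (TensorCoalg.cut_assoc_aux ih)

lemma counit_cut_aux {X Q A M : C} {t : X ⟶ Q} {c : Q ⟶ A ⊗ X} {e : A ⟶ 𝟙_ C}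
    (h : t ≫ c ≫ e ▷ X = (λ_ X).inv) :
    t ▷ M ≫ (c ▷ M ≫ (α_ A X M).hom) ≫ e ▷ (X ⊗ M) = (λ_ (X ⊗ M)).inv := by
  have h' := congrArg (fun f => f ▷ M) h
  simp only [comp_whiskerRight] at h'
  have : (α_ A X M).hom ≫ e ▷ (X ⊗ M) = e ▷ X ▷ M ≫ (α_ _ _ _).hom := by simp
  rw [Category.assoc, this, reassoc_of% h']
  simp

lemma counit_altCut (n : ℕ) :
    eqToHom (congrArg (altPow D W) (Nat.zero_add n).symm) ≫ altCut D W 0 n ≫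
      ε[D] ▷ altPow D W n = (λ_ (altPow D W n)).inv := by
  induction n with
  | zero => exact (Category.id_comp _).trans (ComonObj.counit_comul D)
  | succ n ih =>
    exact (congrArg (fun f => f ≫ (altCut D W 0 n ▷ (W ⊗ D) ≫ (α_ _ _ _).hom) ≫
      ε[D] ▷ (altPow D W n ⊗ (W ⊗ D))) (eqToHom_altPow_succ D W (Nat.zero_add n).symm)).trans
      (counit_cut_aux (M := W ⊗ D) ih)

/-- The projection of `D ⊗ (W ⊗ D)` onto `W`. -/
def altPowOneProj : D ⊗ (W ⊗ D) ⟶ W :=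
  ε[D] ▷ (W ⊗ D) ≫ (λ_ (W ⊗ D)).hom ≫ W ◁ ε[D] ≫ (ρ_ W).hom

lemma cofreeCoact_proj : cofreeCoact D W ≫ (W ◁ ε[D] ≫ (ρ_ W).hom) ▷ D = 𝟙 (W ⊗ D) := by
  have h := congrArg (fun f => W ◁ f) (ComonObj.counit_comul D)
  simp only [MonoidalCategory.whiskerLeft_comp] at h
  rw [cofreeCoact, Category.assoc]
  simp [reassoc_of% h]

lemma coact_altPowOneProj :
    (D ◁ cofreeCoact D W ≫ (α_ D (W ⊗ D) D).inv) ≫ altPowOneProj D W ▷ D =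
      ε[D] ▷ (W ⊗ D) ≫ (λ_ (W ⊗ D)).hom := by
  have h₁ : (α_ D (W ⊗ D) D).inv ≫ ε[D] ▷ (W ⊗ D) ▷ D =
      ε[D] ▷ ((W ⊗ D) ⊗ D) ≫ (α_ (𝟙_ C) (W ⊗ D) D).inv := by simp
  have h₂ : (α_ (𝟙_ C) (W ⊗ D) D).inv ≫ (λ_ (W ⊗ D)).hom ▷ D = (λ_ ((W ⊗ D) ⊗ D)).hom := by simp
  have h₃ := cofreeCoact_proj D W
  rw [comp_whiskerRight] at h₃
  simp only [altPowOneProj, comp_whiskerRight, Category.assoc]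
  rw [reassoc_of% h₁, reassoc_of% h₂, whisker_exchange_assoc,
    leftUnitor_naturality_assoc, h₃, Category.comp_id]

/-- Duplicating the last `D` of a word and then killing the new copy by the counit changes nothing;
this makes the `(n, 1)` cut of the product a split monomorphism. -/
lemma coact_whiskerRight_counit {P M D' : C} {e : D' ⟶ 𝟙_ C} {r : P ⟶ P ⊗ D'}
    (h : r ≫ P ◁ e = (ρ_ P).inv) :
    (r ▷ M ≫ (α_ P D' M).hom) ≫ P ◁ (e ▷ M ≫ (λ_ M).hom) = 𝟙 _ := by
  have h' := congrArg (fun f => f ▷ M) h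
  simp only [comp_whiskerRight] at h'
  have : (α_ P D' M).hom ≫ P ◁ e ▷ M = (P ◁ e) ▷ M ≫ (α_ _ _ _).hom := by simp
  rw [MonoidalCategory.whiskerLeft_comp, Category.assoc, reassoc_of% this, reassoc_of% h']
  simp

lemma comp_counit_leftUnitor {X P Q A : C} {p : X ⟶ P} {p' : X ⟶ Q} {t : P ⟶ Q} {c : Q ⟶ A ⊗ P}
    {e : A ⟶ 𝟙_ C} (hp : p ≫ t = p') (h : t ≫ c ≫ e ▷ P = (λ_ P).inv) :
    (p' ≫ c) ≫ e ▷ P ≫ (λ_ P).hom = p := by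
  subst hp
  simp only [Category.assoc]
  rw [reassoc_of% h, Iso.inv_hom_id, Category.comp_id]

lemma comp_tensorHom_of_comp_whiskerRight {X P P' Q R A : C} {Δ' : X ⟶ P' ⊗ A} {u : P' ⟶ P}
    {f : P ⟶ Q} {v : A ⟶ R} {Z : C} {p : X ⟶ Z} {r : Z ⟶ P ⊗ R} {s : Z ⟶ Q ⊗ R}
    (h₁ : Δ' ≫ (u ⊗ₘ v) = p ≫ r) (h₂ : r ≫ f ▷ R = s) : Δ' ≫ ((u ≫ f) ⊗ₘ v) = p ≫ s := by
  have h₃ : ((u ≫ f) ⊗ₘ v) = (u ⊗ₘ v) ≫ f ▷ R := by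
    rw [← tensorHom_id, tensorHom_comp_tensorHom, Category.comp_id]
  rw [h₃, reassoc_of% h₁, h₂]

variable {D W} {A : C} [ComonObj A]

lemma comul_altPowOneProj (g : A ⟶ D) [IsComonHom g] (h : A ⟶ W) :
    (Δ ≫ (g ⊗ₘ (Δ ≫ (h ⊗ₘ g)))) ≫ altPowOneProj D W = h := by
  have h₁ : (g ⊗ₘ (Δ ≫ (h ⊗ₘ g))) ≫ ε[D] ▷ (W ⊗ D) = (ε[A] ⊗ₘ (Δ ≫ (h ⊗ₘ g))) := by
    rw [← tensorHom_id, tensorHom_comp_tensorHom, IsComonHom.hom_counit, Category.comp_id]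
  have h₂ : (h ⊗ₘ g) ≫ W ◁ ε[D] = (h ⊗ₘ ε[A]) := by
    rw [← id_tensorHom, tensorHom_comp_tensorHom, IsComonHom.hom_counit, Category.comp_id]
  rw [altPowOneProj, Category.assoc, reassoc_of% h₁, ComonObj.counit_comul_hom_assoc]
  simp [reassoc_of% h₂]

/-- The components of the map induced by maps to `D` and to `W`. -/
def altComponent (g : A ⟶ D) (h : A ⟶ W) : ∀ n, A ⟶ altPow D W n
  | 0 => g
  | n + 1 => Δ ≫ (altComponent g h n ⊗ₘ (Δ ≫ (h ⊗ₘ g)))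

lemma comp_coact_aux {P M D' : C} {f : A ⟶ P} {k : A ⟶ M} {g : A ⟶ D'} {r : M ⟶ M ⊗ D'}
    (h : k ≫ r = Δ ≫ (k ⊗ₘ g)) :
    (Δ ≫ (f ⊗ₘ k)) ≫ P ◁ r ≫ (α_ P M D').inv = Δ ≫ ((Δ ≫ (f ⊗ₘ k)) ⊗ₘ g) := by
  have h₁ : (f ⊗ₘ k) ≫ P ◁ r = A ◁ Δ ≫ (f ⊗ₘ (k ⊗ₘ g)) := by
    rw [MonoidalCategory.tensorHom_def, MonoidalCategory.tensorHom_def, Category.assoc,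
      ← MonoidalCategory.whiskerLeft_comp, h, MonoidalCategory.whiskerLeft_comp,
      whisker_exchange_assoc]
  rw [Category.assoc, reassoc_of% h₁, associator_inv_naturality, ComonObj.comul_assoc_assoc]
  simp [MonoidalCategory.tensorHom_def]

lemma comp_cofreeCoact (g : A ⟶ D) [IsComonHom g] (h : A ⟶ W) :
    (Δ ≫ (h ⊗ₘ g)) ≫ cofreeCoact D W = Δ ≫ ((Δ ≫ (h ⊗ₘ g)) ⊗ₘ g) :=
  comp_coact_aux (IsComonHom.hom_comul g)

/-- The coaction only touches the last letter, which is the image of `g`, a coalgebra map. -/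
lemma altComponent_coact (g : A ⟶ D) [IsComonHom g] (h : A ⟶ W) (n : ℕ) :
    altComponent g h n ≫ altCoact D W n = Δ ≫ (altComponent g h n ⊗ₘ g) := by
  cases n with
  | zero => exact IsComonHom.hom_comul g
  | succ n => exact comp_coact_aux (comp_cofreeCoact g h)

lemma altComponent_cut (g : A ⟶ D) [IsComonHom g] (h : A ⟶ W) (a b : ℕ) :
    altComponent g h (a + b) ≫ altCut D W a b =
      Δ ≫ (altComponent g h a ⊗ₘ altComponent g h b) := by
  induction b with
  | zero => exact altComponent_coact g h a
  | succ b ih => exact ComonObj.comul_tensorHom_step ih _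

end Cut
end DGVct

/-! ### The product coalgebra and its universal property. -/

namespace DGVct

variable {K : Type u} [Field K]

section CofreeProduct

variable (D W : DGVct K)

lemma altPow_zeroBelow {W : DGVct K} (hW : IsZero (W.X 0)) (n : ℕ) :
    ZeroBelow n (altPow D W n) := by
  have h₁ : ZeroBelow 1 W := fun m hm => by
    obtain rfl : m = 0 := by omega
    exact hW
  have h₀ : ZeroBelow 0 D := fun m hm => absurd hm (Nat.not_lt_zero m)
  induction n with
  | zero => exact h₀
  | succ n ih => exact ih.tensor (h₁.tensor h₀)

/-- The complex `⨁ₙ D ⊗ (W ⊗ D)^{⊗ n}` underlying the product of `D` and the tensor coalgebra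
on `W`. -/
def cofreeProd : DGVct K := ∐ altPow D W

variable {W} (hW : IsZero (W.X 0))

/-- The decomposition of `⨁ₙ D ⊗ (W ⊗ D)^{⊗ n}` into its summands. -/
def cofreeProdSum : Decomposition (cofreeProd D W) (altPow D W) :=
  Decomposition.sigma _ (altPow_zeroBelow D hW)

lemma Decomposition.π_eqToHom {X : DGVct K} {Y : ℕ → DGVct K} (S : Decomposition X Y) {m n : ℕ}
    (h : m = n) : S.π m ≫ eqToHom (congrArg Y h) = S.π n := by
  subst h
  exact Category.comp_id _

variable [ComonObj D]

/-- The comultiplication of `⨁ₙ D ⊗ (W ⊗ D)^{⊗ n}`. -/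
def cofreeProdComul : cofreeProd D W ⟶ cofreeProd D W ⊗ cofreeProd D W :=
  (cofreeProdSum D hW).lift₂ fun a b => (cofreeProdSum D hW).π (a + b) ≫ altCut D W a b

lemma cofreeProdComul_π (a b : ℕ) :
    cofreeProdComul D hW ≫ ((cofreeProdSum D hW).π a ⊗ₘ (cofreeProdSum D hW).π b) =
      (cofreeProdSum D hW).π (a + b) ≫ altCut D W a b :=
  (cofreeProdSum D hW).lift₂_π _ a b

/-- The projection of `⨁ₙ D ⊗ (W ⊗ D)^{⊗ n}` onto `D`. -/
def cofreeProdFst : cofreeProd D W ⟶ D := (cofreeProdSum D hW).π 0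

/-- The counit of `⨁ₙ D ⊗ (W ⊗ D)^{⊗ n}`. -/
def cofreeProdCounit : cofreeProd D W ⟶ 𝟙_ (DGVct K) := cofreeProdFst D hW ≫ ε[D]

lemma cofreeProd_counit_comul :
    cofreeProdComul D hW ≫ cofreeProdCounit D hW ▷ cofreeProd D W =
      (λ_ (cofreeProd D W)).inv := by
  let S := cofreeProdSum D hW
  rw [← cancel_mono (λ_ (cofreeProd D W)).hom, Iso.inv_hom_id]
  refine S.hom_ext fun n => ?_
  have h₁ : (cofreeProdComul D hW ≫ cofreeProdCounit D hW ▷ cofreeProd D W) ≫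
      (λ_ (cofreeProd D W)).hom ≫ S.π n =
      (cofreeProdComul D hW ≫ (cofreeProdFst D hW ⊗ₘ S.π n)) ≫
        ε[D] ▷ altPow D W n ≫ (λ_ (altPow D W n)).hom := by
    rw [cofreeProdCounit]
    simp [MonoidalCategory.tensorHom_def, whisker_exchange_assoc]
  have h₂ : cofreeProdComul D hW ≫ (cofreeProdFst D hW ⊗ₘ S.π n) =
      S.π (0 + n) ≫ altCut D W 0 n := cofreeProdComul_π D hW 0 n
  rw [Category.assoc, h₁, h₂, Category.id_comp]
  -- The transport appears because `0 + n` is not definitionally `n`; the right-hand law needs none.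
  exact comp_counit_leftUnitor (S.π_eqToHom (Nat.zero_add n).symm) (counit_altCut D W n)

lemma cofreeProd_comul_counit :
    cofreeProdComul D hW ≫ cofreeProd D W ◁ cofreeProdCounit D hW =
      (ρ_ (cofreeProd D W)).inv := by
  let S := cofreeProdSum D hW
  rw [← cancel_mono (ρ_ (cofreeProd D W)).hom, Iso.inv_hom_id]
  refine S.hom_ext fun n => ?_
  have h₁ : (cofreeProdComul D hW ≫ cofreeProd D W ◁ cofreeProdCounit D hW) ≫
      (ρ_ (cofreeProd D W)).hom ≫ S.π n =
      (cofreeProdComul D hW ≫ (S.π n ⊗ₘ cofreeProdFst D hW)) ≫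
        altPow D W n ◁ ε[D] ≫ (ρ_ (altPow D W n)).hom := by
    rw [cofreeProdCounit]
    simp [MonoidalCategory.tensorHom_def', ← whisker_exchange_assoc]
  have h₂ : cofreeProdComul D hW ≫ (S.π n ⊗ₘ cofreeProdFst D hW) =
      S.π n ≫ altCoact D W n := cofreeProdComul_π D hW n 0
  have h₃ := altCoact_counit D W n
  rw [Category.assoc, h₁, h₂, Category.assoc, reassoc_of% h₃]
  simp

lemma cofreeProd_comul_assoc :
    cofreeProdComul D hW ≫ cofreeProd D W ◁ cofreeProdComul D hW =
      cofreeProdComul D hW ≫ cofreeProdComul D hW ▷ cofreeProd D W ≫ (α_ _ _ _).hom := by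
  let S := cofreeProdSum D hW
  refine S.hom_ext₃ fun a b c => ?_
  have hΔ : ∀ a b, cofreeProdComul D hW ≫ (S.π a ⊗ₘ S.π b) = S.π (a + b) ≫ altCut D W a b :=
    cofreeProdComul_π D hW
  have hL : (cofreeProdComul D hW ≫ cofreeProd D W ◁ cofreeProdComul D hW) ≫
      (S.π a ⊗ₘ S.π b ⊗ₘ S.π c) =
      (cofreeProdComul D hW ≫ (S.π a ⊗ₘ S.π (b + c))) ≫ altPow D W a ◁ altCut D W b c := by
    rw [Category.assoc, Category.assoc, ← id_tensorHom, ← id_tensorHom, tensorHom_comp_tensorHom,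
      tensorHom_comp_tensorHom, hΔ, Category.id_comp, Category.comp_id]
  have hR : (cofreeProdComul D hW ≫ cofreeProdComul D hW ▷ cofreeProd D W ≫ (α_ _ _ _).hom) ≫
      (S.π a ⊗ₘ S.π b ⊗ₘ S.π c) =
      (cofreeProdComul D hW ≫ (S.π (a + b) ⊗ₘ S.π c)) ≫ altCut D W a b ▷ altPow D W c ≫
        (α_ _ _ _).hom := by
    simp only [Category.assoc]
    rw [← associator_naturality, ← tensorHom_id, ← tensorHom_id, tensorHom_comp_tensorHom_assoc,
      tensorHom_comp_tensorHom_assoc, hΔ, Category.id_comp, Category.comp_id]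
  rw [hL, hR, hΔ, hΔ, Category.assoc, Category.assoc, ← altCut_assoc,
    ← S.π_eqToHom (Nat.add_assoc a b c), Category.assoc]

/-- The DG coalgebra `⨁ₙ D ⊗ (W ⊗ D)^{⊗ n}`. -/
@[reducible]
def cofreeProdComonObj : ComonObj (cofreeProd D W) where
  counit := cofreeProdCounit D hW
  comul := cofreeProdComul D hW
  counit_comul := cofreeProd_counit_comul D hW
  comul_counit := cofreeProd_comul_counit D hW
  comul_assoc := cofreeProd_comul_assoc D hW

/-- The product of `D` and the tensor coalgebra on `W`. -/
def cofreeProdComon : Comon (DGVct K) :=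
  letI := cofreeProdComonObj D hW
  ⟨cofreeProd D W⟩

/-- The decomposition of `⨁ₙ D ⊗ (W ⊗ D)^{⊗ n}` into its summands. -/
def cofreeProdDecomposition : CutDecomposition (cofreeProdComon D hW).X (altPow D W) where
  toDecomposition := cofreeProdSum D hW
  cut := altCut D W
  counit₀ := ε[D]
  comul_π := cofreeProdComul_π D hW
  π_counit := rfl

/-- The projection of `⨁ₙ D ⊗ (W ⊗ D)^{⊗ n}` onto `D`, as a map of coalgebras. -/
def cofreeProdπ : (cofreeProdComon D hW).X ⟶ D := (cofreeProdDecomposition D hW).π 0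

lemma isComonHom_cofreeProdπ : IsComonHom (cofreeProdπ D hW) where
  hom_counit := rfl
  hom_comul := (cofreeProdComul_π D hW 0 0).symm

/-- The projection of `⨁ₙ D ⊗ (W ⊗ D)^{⊗ n}` onto `W`. -/
def cofreeProdProj : (cofreeProdComon D hW).X ⟶ W :=
  (cofreeProdDecomposition D hW).π 1 ≫ altPowOneProj D W

/-- Uniqueness is tested on the `W ⊗ D` part of the first component, while the given data are maps
to `W` and to `D`; this identity recovers the former from the latter. -/
lemma cofreeProd_comul_proj_π :
    Δ[(cofreeProdComon D hW).X] ≫ (cofreeProdProj D hW ⊗ₘ cofreeProdπ D hW) =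
      (cofreeProdDecomposition D hW).π 1 ≫ ε[D] ▷ (W ⊗ D) ≫ (λ_ (W ⊗ D)).hom := by
  exact comp_tensorHom_of_comp_whiskerRight ((cofreeProdDecomposition D hW).comul_π 1 0)
    (coact_altPowOneProj D W)

variable {D} {A : DGVct K} [ComonObj A]

lemma exists_cofreeProd_lift (g : A ⟶ D) [IsComonHom g] (h : A ⟶ W) :
    ∃ φ : A ⟶ (cofreeProdComon D hW).X, IsComonHom φ ∧ φ ≫ cofreeProdπ D hW = g ∧
      φ ≫ cofreeProdProj D hW = h := by
  let S := cofreeProdDecomposition D hW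
  refine ⟨S.lift (altComponent g h), S.isComonHom_lift _ (IsComonHom.hom_counit g)
    (altComponent_cut g h), S.lift_π (altComponent g h) 0, ?_⟩
  have h₁ : S.lift (altComponent g h) ≫ S.π 1 = Δ ≫ (g ⊗ₘ (Δ ≫ (h ⊗ₘ g))) :=
    S.lift_π (altComponent g h) 1
  have h₂ : (Δ ≫ (g ⊗ₘ (Δ ≫ (h ⊗ₘ g)))) ≫ altPowOneProj D W = h :=
    comul_altPowOneProj g h
  exact (Category.assoc _ _ _).symm.trans ((congrArg (fun x => x ≫ altPowOneProj D W) h₁).trans h₂)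

lemma cofreeProd_comonHom_ext {φ ψ : A ⟶ (cofreeProdComon D hW).X} (hφ : IsComonHom φ)
    (hψ : IsComonHom ψ)
    (h₀ : φ ≫ cofreeProdπ D hW = ψ ≫ cofreeProdπ D hW)
    (h₁ : φ ≫ cofreeProdProj D hW = ψ ≫ cofreeProdProj D hW) : φ = ψ := by
  let S := cofreeProdDecomposition D hW
  refine S.comonHom_ext (M := W ⊗ D) (ε[D] ▷ (W ⊗ D) ≫ (λ_ (W ⊗ D)).hom) (fun n => ?_) h₀ ?_
  · have : (altCoact D W n ▷ (W ⊗ D) ≫ (α_ (altPow D W n) D (W ⊗ D)).hom) ≫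
        altPow D W n ◁ (ε[D] ▷ (W ⊗ D) ≫ (λ_ (W ⊗ D)).hom) = 𝟙 _ :=
      coact_whiskerRight_counit (altCoact_counit D W n)
    change Mono ((altCoact D W n ▷ (W ⊗ D) ≫ (α_ (altPow D W n) D (W ⊗ D)).hom) ≫
        altPow D W n ◁ (ε[D] ▷ (W ⊗ D) ≫ (λ_ (W ⊗ D)).hom))
    rw [this]
    infer_instance
  · have e : ∀ (θ : A ⟶ (cofreeProdComon D hW).X) [IsComonHom θ],
        θ ≫ S.π 1 ≫ ε[D] ▷ (W ⊗ D) ≫ (λ_ (W ⊗ D)).hom =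
          Δ ≫ ((θ ≫ cofreeProdProj D hW) ⊗ₘ (θ ≫ cofreeProdπ D hW)) := by
      intro θ _
      rw [← tensorHom_comp_tensorHom, ← IsComonHom.hom_comul_assoc, cofreeProd_comul_proj_π]
    rw [e φ, e ψ, h₀, h₁]

end CofreeProduct
end DGVct

/-! ### Contractibility, maps into cones, and the counit in degree 0. -/

namespace DGVct

variable {K : Type u} [Field K]

/-- A complex is contractible if its identity is homotopic to zero. -/
def Contractible (A : DGVct K) : Prop := Nonempty (Homotopy (𝟙 A) 0)

lemma Contractible.tensor_left {A : DGVct K} (B : DGVct K) (h : Contractible A) :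
    Contractible (A ⊗ B : DGVct K) := by
  obtain ⟨H⟩ := h
  have h₁ : HomologicalComplex.mapBifunctorMap (𝟙 A) (𝟙 B) (curriedTensor (ModuleCat.{u} K))
      (ComplexShape.down ℕ) = 𝟙 (A ⊗ B : DGVct K) := id_tensorHom_id A B
  have h₂ : HomologicalComplex.mapBifunctorMap (0 : A ⟶ A) (𝟙 B) (curriedTensor (ModuleCat.{u} K))
      (ComplexShape.down ℕ) = (0 : (A ⊗ B : DGVct K) ⟶ A ⊗ B) :=
    (MonoidalPreadditive.zero_whiskerRight : (0 : A ⟶ A) ▷ B = 0)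
  exact ⟨(Homotopy.ofEq h₁.symm).trans
    ((HomologicalComplex.mapBifunctorMapHomotopy₁ H (𝟙 B) (curriedTensor (ModuleCat.{u} K))
      (ComplexShape.down ℕ)).trans (Homotopy.ofEq h₂))⟩

lemma Contractible.tensor_right (A : DGVct K) {B : DGVct K} (h : Contractible B) :
    Contractible (A ⊗ B : DGVct K) := by
  obtain ⟨H⟩ := h
  have h₁ : HomologicalComplex.mapBifunctorMap (𝟙 A) (𝟙 B) (curriedTensor (ModuleCat.{u} K))
      (ComplexShape.down ℕ) = 𝟙 (A ⊗ B : DGVct K) := id_tensorHom_id A B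
  have h₂ : HomologicalComplex.mapBifunctorMap (𝟙 A) (0 : B ⟶ B) (curriedTensor (ModuleCat.{u} K))
      (ComplexShape.down ℕ) = (0 : (A ⊗ B : DGVct K) ⟶ A ⊗ B) :=
    (MonoidalPreadditive.whiskerLeft_zero : A ◁ (0 : B ⟶ B) = 0)
  exact ⟨(Homotopy.ofEq h₁.symm).trans
    ((HomologicalComplex.mapBifunctorMapHomotopy₂ (𝟙 A) H (curriedTensor (ModuleCat.{u} K))
      (ComplexShape.down ℕ)).trans (Homotopy.ofEq h₂))⟩

lemma down_rel_succ (n : ℕ) : (ComplexShape.down ℕ).Rel (n + 1) n := rfl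

lemma not_down_rel_zero (n : ℕ) : ¬ (ComplexShape.down ℕ).Rel 0 n := Nat.succ_ne_zero n

open HomologicalComplex in
lemma contractible_cone (V : DGVct K) : Contractible (homotopyCofiber (𝟙 V)) := by
  refine ⟨{
    -- The homotopy moves the summand `V_i` of degree `i` to the summand `V_i` of degree `i + 1`.
    hom := fun i j => if h : (ComplexShape.down ℕ).Rel j i then
      homotopyCofiber.sndX (𝟙 V) i ≫ homotopyCofiber.inlX (𝟙 V) i j h else 0
    zero := fun i j h => dif_neg h
    comm := fun i => ?_ }⟩
  have hi : (ComplexShape.down ℕ).Rel (i + 1) i := rfl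
  rw [prevD_eq _ hi, dif_pos hi]
  cases i with
  | zero =>
    rw [dNext_eq_zero _ _ (not_down_rel_zero _)]
    refine homotopyCofiber.ext_from_X' (𝟙 V) 0 (not_down_rel_zero _) ?_
    simp [homotopyCofiber.inlX_d' _ _ _ hi (not_down_rel_zero _)]
  | succ i =>
    have hj : (ComplexShape.down ℕ).Rel (i + 1) i := rfl
    rw [dNext_eq _ hj, dif_pos hj]
    refine homotopyCofiber.ext_from_X (𝟙 V) _ _ hj ?_ ?_
    · simp [homotopyCofiber.d_sndX_assoc _ _ _ hj]
    · simp [homotopyCofiber.d_sndX_assoc _ _ _ hj, homotopyCofiber.inlX_d _ _ _ _ hi hj]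

open HomologicalComplex in
/-- The map of complexes into a cone determined by its second components. -/
def coneLift {B V : DGVct K} (hV : IsZero (V.X 0)) (α : ∀ n, B.X n ⟶ V.X n) :
    B ⟶ homotopyCofiber (𝟙 V) where
  -- The cone vanishes in degree 0. In degree `n + 1` the first component is forced by the chain map
  -- condition.
  f n := match n with
    | 0 => 0
    | n + 1 => (B.d (n + 1) n ≫ α n - α (n + 1) ≫ V.d (n + 1) n) ≫
        homotopyCofiber.inlX (𝟙 V) n (n + 1) (down_rel_succ n) + α (n + 1) ≫ homotopyCofiber.inrX (𝟙 V) (n + 1)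
  comm' i j hij := by
    have h : j + 1 = i := hij
    subst h
    cases j with
    | zero =>
      exact (homotopyCofiber.isZero_X (𝟙 V) 0 hV
        (fun _ h => absurd h (Nat.succ_ne_zero _))).eq_of_tgt _ _
    | succ j =>
      refine homotopyCofiber.ext_to_X (𝟙 V) (j + 1) j (down_rel_succ j) ?_ ?_
      · simp [homotopyCofiber.d_fstX (𝟙 V) (j + 2) (j + 1) j (down_rel_succ _) (down_rel_succ _)]
      · simp [homotopyCofiber.d_sndX (𝟙 V) (j + 2) (j + 1) (down_rel_succ _)]

open HomologicalComplex in
lemma coneLift_sndX {B V : DGVct K} (hV : IsZero (V.X 0)) (α : ∀ n, B.X n ⟶ V.X n) (n : ℕ) :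
    (coneLift hV α).f n ≫ homotopyCofiber.sndX (𝟙 V) n = α n := by
  cases n with
  | zero => exact hV.eq_of_tgt _ _
  | succ n =>
    change ((B.d (n + 1) n ≫ α n - α (n + 1) ≫ V.d (n + 1) n) ≫
        homotopyCofiber.inlX (𝟙 V) n (n + 1) (down_rel_succ n) +
      α (n + 1) ≫ homotopyCofiber.inrX (𝟙 V) (n + 1)) ≫ homotopyCofiber.sndX (𝟙 V) (n + 1) = _
    rw [Preadditive.add_comp, Category.assoc, Category.assoc, homotopyCofiber.inlX_sndX,
      homotopyCofiber.inrX_sndX, comp_zero, zero_add, Category.comp_id]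

open HomologicalComplex in
lemma cone_hom_ext {B V : DGVct K} {φ ψ : B ⟶ homotopyCofiber (𝟙 V)}
    (h : ∀ n, φ.f n ≫ homotopyCofiber.sndX (𝟙 V) n = ψ.f n ≫ homotopyCofiber.sndX (𝟙 V) n) :
    φ = ψ := by
  ext1 n
  cases n with
  | zero => exact homotopyCofiber.ext_to_X' (𝟙 V) 0 (not_down_rel_zero _) (h 0)
  | succ n =>
    refine homotopyCofiber.ext_to_X (𝟙 V) (n + 1) n (down_rel_succ n) ?_ (h (n + 1))
    -- The second component of the chain map condition, solved for the first component of `θ`.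
    have e : ∀ θ : B ⟶ homotopyCofiber (𝟙 V),
        θ.f (n + 1) ≫ homotopyCofiber.fstX (𝟙 V) (n + 1) n (down_rel_succ n) =
          B.d (n + 1) n ≫ θ.f n ≫ homotopyCofiber.sndX (𝟙 V) n -
            (θ.f (n + 1) ≫ homotopyCofiber.sndX (𝟙 V) (n + 1)) ≫ V.d (n + 1) n := by
      intro θ
      have h₁ := congrArg (fun x => x ≫ homotopyCofiber.sndX (𝟙 V) n) (θ.comm (n + 1) n)
      simp only [homotopyCofiber_d, Category.assoc,
        homotopyCofiber.d_sndX (𝟙 V) (n + 1) n (down_rel_succ n), Preadditive.comp_add, id_f,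
        Category.comp_id] at h₁
      rw [← h₁]
      simp
    rw [e, e, h, h]

open HomologicalComplex in
-- Degreewise linear retractions of `i` extend the second components of `φ`. They need not commute
-- with differentials, since `coneLift` accepts any family of linear maps.
lemma exists_cone_extension {A B V : DGVct K} (hV : IsZero (V.X 0)) (i : A ⟶ B)
    (hi : ∀ n, Function.Injective (i.f n)) (φ : A ⟶ homotopyCofiber (𝟙 V)) :
    ∃ ψ : B ⟶ homotopyCofiber (𝟙 V), i ≫ ψ = φ := by
  have hr : ∀ n, ∃ r : B.X n ⟶ A.X n, i.f n ≫ r = 𝟙 _ := by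
    intro n
    obtain ⟨r, hr⟩ := (i.f n).hom.exists_leftInverse_of_injective
      (LinearMap.ker_eq_bot.2 (hi n))
    exact ⟨ModuleCat.ofHom r, by ext1; exact hr⟩
  choose r hr using hr
  refine ⟨coneLift hV fun n => r n ≫ φ.f n ≫ homotopyCofiber.sndX (𝟙 V) n,
    cone_hom_ext fun n => ?_⟩
  rw [comp_f, Category.assoc, coneLift_sndX, reassoc_of% (hr n)]

/-- The quotient map of a complex by its degree zero part. -/
def toModDegreeZero (V : DGVct K) : V ⟶ modDegreeZero V where
  f n := match n with
    | 0 => 0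
    | n + 1 => 𝟙 (V.X (n + 1))
  comm' i j hij := by
    have h : j + 1 = i := hij
    subst h
    cases j with
    | zero => exact (ModuleCat.isZero_of_subsingleton (ModuleCat.of K PUnit)).eq_of_tgt _ _
    | succ j => exact (Category.id_comp _).trans (Category.comp_id _).symm

/-- A linear map out of the simple module `C_0` is injective or zero. If the counit were zero in
degree 0, the counit law would make the identity of `C_0` zero. -/
lemma counit_f_zero_injective (C : DGVct K) [ComonObj C]
    (hC : Nonempty (C.X 0 ≅ ModuleCat.of K K)) : Function.Injective (ε[C].f 0) := by
  obtain ⟨e⟩ := hC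
  have hs : IsSimpleModule K (C.X 0) := IsSimpleModule.congr e.toLinearEquiv
  refine (LinearMap.injective_or_eq_zero (ε[C].f 0).hom).resolve_right fun h => ?_
  have h₀ : AgreeUpTo 0 ε[C] 0 := by
    intro m hm
    obtain rfl : m = 0 := by omega
    ext1
    exact h
  have h₁ := (h₀.tensorHom (f' := 𝟙 C) (g' := 𝟙 C) fun _ _ => rfl).comp_left Δ[C]
  rw [tensorHom_id, ComonObj.counit_comul, tensorHom_id,
    MonoidalPreadditive.zero_whiskerRight, comp_zero] at h₁
  have h₂ : (𝟙 C : C ⟶ C).f 0 = 0 := by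
    rw [← (λ_ C).inv_hom_id, HomologicalComplex.comp_f, h₁ 0 le_rfl]
    exact zero_comp
  have h₃ : IsZero (C.X 0) := (IsZero.iff_id_eq_zero _).2 h₂
  have := ModuleCat.subsingleton_of_isZero h₃
  have := IsSimpleModule.nontrivial K (C.X 0)
  exact not_subsingleton (C.X 0) ‹_›

end DGVct

/-! ### The factorization for connected coalgebras. -/

namespace DGcoAlgConn

open DGVct

variable {K : Type u} [Field K]

lemma cofreeProd_isConnected (D : DGcoAlgConn K) {W : DGVct K} (hW : IsZero (W.X 0)) :
    DGcoAlg.isConnected K (cofreeProdComon D.obj.X hW) := by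
  let S := cofreeProdSum D.obj.X hW
  obtain ⟨e⟩ := D.property
  have h₁ : (S.π 0).f 0 ≫ (S.ι 0).f 0 = 𝟙 _ := by
    -- In degree 0 only the summand `D` survives.
    have := S.agree_sum 0 0 le_rfl
    simpa using this
  have h₂ : (S.ι 0).f 0 ≫ (S.π 0).f 0 = 𝟙 _ := by
    rw [← HomologicalComplex.comp_f, S.ι_π_self]
    rfl
  exact ⟨(Iso.mk ((S.π 0).f 0) ((S.ι 0).f 0) h₁ h₂ :
    (cofreeProd D.obj.X W).X 0 ≅ D.obj.X.X 0) ≪≫ e⟩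

/-- The product of a connected DG coalgebra and a tensor coalgebra. -/
def cofreeProduct (D : DGcoAlgConn K) (W : DGVctConn K) : DGcoAlgConn K :=
  ⟨cofreeProdComon D.obj.X W.property, D.cofreeProd_isConnected W.property⟩

/-- The map of connected DG coalgebras with a given underlying map of complexes. -/
def homMk {C D : DGcoAlgConn K} (φ : C.obj.X ⟶ D.obj.X) (h : IsComonHom φ) : C ⟶ D :=
  ObjectProperty.homMk (Comon.Hom.mk φ)

lemma hom_ext' {C D : DGcoAlgConn K} {φ ψ : C ⟶ D} (h : φ.hom.hom = ψ.hom.hom) : φ = ψ :=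
  ObjectProperty.hom_ext _ (Comon.ext h)

/-- The first projection of the product. -/
def cofreeProductFst (D : DGcoAlgConn K) (W : DGVctConn K) : cofreeProduct D W ⟶ D :=
  homMk (C := cofreeProduct D W) (cofreeProdπ D.obj.X W.property)
    (isComonHom_cofreeProdπ D.obj.X W.property)

/-- The second projection of the product. -/
def cofreeProductSnd (D : DGcoAlgConn K) (W : DGVctConn K) :
    cofreeProduct D W ⟶ W.tensorCoalg :=
  have h := exists_tensorCoalg_lift W.property (cofreeProdProj D.obj.X W.property)
  homMk (C := cofreeProduct D W) (D := W.tensorCoalg) h.choose h.choose_spec.1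

lemma cofreeProductSnd_proj (D : DGcoAlgConn K) (W : DGVctConn K) :
    (cofreeProductSnd D W).hom.hom ≫ tensorCoalgProj W.property =
      cofreeProdProj D.obj.X W.property :=
  (exists_tensorCoalg_lift W.property (cofreeProdProj D.obj.X W.property)).choose_spec.2

lemma exists_cofreeProduct_lift {A D : DGcoAlgConn K} (W : DGVctConn K) (g : A ⟶ D)
    (h : A.obj.X ⟶ W.obj) :
    ∃ φ : A ⟶ cofreeProduct D W, φ ≫ cofreeProductFst D W = g ∧
      φ.hom.hom ≫ cofreeProdProj D.obj.X W.property = h := by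
  obtain ⟨φ, hφ, h₁, h₂⟩ := exists_cofreeProd_lift W.property g.hom.hom h
  exact ⟨homMk (D := cofreeProduct D W) φ hφ, hom_ext' h₁, h₂⟩

lemma cofreeProduct_hom_ext {A D : DGcoAlgConn K} {W : DGVctConn K}
    {φ ψ : A ⟶ cofreeProduct D W}
    (h₁ : φ ≫ cofreeProductFst D W = ψ ≫ cofreeProductFst D W)
    (h₂ : φ.hom.hom ≫ cofreeProdProj D.obj.X W.property =
      ψ.hom.hom ≫ cofreeProdProj D.obj.X W.property) : φ = ψ :=
  hom_ext' (cofreeProd_comonHom_ext W.property φ.hom.isComonHom_hom ψ.hom.isComonHom_hom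
    (congrArg (fun f : A ⟶ D => f.hom.hom) h₁) h₂)

lemma tensorCoalg_hom_ext {A : DGcoAlgConn K} {W : DGVctConn K} {φ ψ : A ⟶ W.tensorCoalg}
    (h : φ.hom.hom ≫ tensorCoalgProj W.property = ψ.hom.hom ≫ tensorCoalgProj W.property) :
    φ = ψ :=
  hom_ext' (tensorCoalg_comonHom_ext W.property φ.hom.isComonHom_hom ψ.hom.isComonHom_hom h)

lemma cofreeProduct_isLimit (D : DGcoAlgConn K) (W : DGVctConn K) :
    Nonempty (IsLimit (BinaryFan.mk (cofreeProductFst D W) (cofreeProductSnd D W))) := by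
  have hcomp : ∀ {A : DGcoAlgConn K} (φ : A ⟶ cofreeProduct D W),
      (φ ≫ cofreeProductSnd D W).hom.hom ≫ tensorCoalgProj W.property =
        φ.hom.hom ≫ cofreeProdProj D.obj.X W.property := by
    intro A φ
    rw [← cofreeProductSnd_proj D W]
    exact Category.assoc _ _ _
  have hex : ∀ (A : DGcoAlgConn K) (g : A ⟶ D) (t : A ⟶ W.tensorCoalg),
      ∃ φ : A ⟶ cofreeProduct D W, φ ≫ cofreeProductFst D W = g ∧
        φ ≫ cofreeProductSnd D W = t := by
    intro A g t
    obtain ⟨φ, h₁, h₂⟩ := exists_cofreeProduct_lift W g (t.hom.hom ≫ tensorCoalgProj W.property)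
    exact ⟨φ, h₁, tensorCoalg_hom_ext ((hcomp φ).trans h₂)⟩
  choose l hl using hex
  refine ⟨BinaryFan.IsLimit.mk _ (fun f g => l _ f g) (fun f g => (hl _ f g).1)
    (fun f g => (hl _ f g).2) fun f g m h₁ h₂ => cofreeProduct_hom_ext ?_ ?_⟩
  · exact h₁.trans (hl _ f g).1.symm
  · rw [← hcomp, ← hcomp, (hl _ f g).2]
    exact congrArg (fun x => x.hom.hom ≫ tensorCoalgProj W.property) h₂

lemma cofreeProductFst_quasiIso (D : DGcoAlgConn K) (W : DGVctConn K)
    (hW : Contractible W.obj) : weakEquivalences K (cofreeProductFst D W) :=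
  (cofreeProdSum D.obj.X W.property).quasiIso_π_zero fun n =>
    Contractible.tensor_right (altPow D.obj.X W.obj n) (hW.tensor_left D.obj.X)

/-- A lift is a map into the product whose `D` component is `v`; its `W` component is an extension
of a chain map to the cone along `i`. Only injectivity of `i` enters. -/
lemma cofreeProductFst_cone_fibration (D : DGcoAlgConn K) (V : DGVctConn K) :
    fibrations K (cofreeProductFst D V.cone) := by
  intro A B i hi
  refine ⟨fun {u v} sq => ?_⟩
  obtain ⟨h, hh⟩ := exists_cone_extension V.property i.hom.hom hi.1
    (u.hom.hom ≫ cofreeProdProj D.obj.X V.cone.property)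
  obtain ⟨l, h₁, h₂⟩ := exists_cofreeProduct_lift V.cone v h
  refine ⟨⟨⟨l, cofreeProduct_hom_ext ?_ ?_, h₁⟩⟩⟩
  · rw [Category.assoc, h₁, sq.w]
  · refine (Category.assoc _ _ _).trans ?_
    rw [h₂]
    exact hh

/-- The inclusion of `C / C_0` in its cone, as a map from `C`. -/
def toCone (C : DGcoAlgConn K) : C.obj.X ⟶ C.reduced.cone.obj :=
  toModDegreeZero C.obj.X ≫ HomologicalComplex.homotopyCofiber.inr (𝟙 (modDegreeZero C.obj.X))

lemma toCone_f_succ_sndX (C : DGcoAlgConn K) (n : ℕ) :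
    C.toCone.f (n + 1) ≫
      HomologicalComplex.homotopyCofiber.sndX (𝟙 (modDegreeZero C.obj.X)) (n + 1) =
        𝟙 (C.obj.X.X (n + 1)) :=
  (Category.assoc _ _ _).trans ((Category.id_comp _).trans
    (HomologicalComplex.homotopyCofiber.inrX_sndX (𝟙 (modDegreeZero C.obj.X)) (n + 1)))

lemma cofibration_of_proj {C D : DGcoAlgConn K} {i : C ⟶ cofreeProduct D C.reduced.cone}
    (h : i.hom.hom ≫ cofreeProdProj D.obj.X C.reduced.cone.property = C.toCone) :
    cofibrations K i := by
  intro n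
  cases n with
  | zero =>
    have h₂ := counit_f_zero_injective C.obj.X C.property
    -- The injective counit of `C` factors through `i`, so `i` is injective in degree 0.
    rw [← IsComonHom.hom_counit i.hom.hom, HomologicalComplex.comp_f] at h₂
    exact fun a b hab => h₂ (congrArg (ε[(cofreeProduct D C.reduced.cone).obj.X].f 0) hab)
  | succ n =>
    have h₁ := C.toCone_f_succ_sndX n
    rw [← h] at h₁
    -- Projecting to `W` and then to the second summand of the cone retracts `i` in degree `n + 1`.
    have : Mono (i.hom.hom.f (n + 1)) :=
      (SplitMono.mk (f := i.hom.hom.f (n + 1)) _ ((Category.assoc _ _ _).symm.trans h₁)).mono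
    exact (ModuleCat.mono_iff_injective _).1 this

end DGcoAlgConn
end

theorem mainTheorem4 (K : Type u) [Field K] (C D : DGcoAlgConn K) (f : C ⟶ D) :
    ∃ (X : DGcoAlgConn K) (i : C ⟶ X) (p : X ⟶ D) (π : X ⟶ C.reduced.cone.tensorCoalg),
      Nonempty (IsLimit (BinaryFan.mk p π)) ∧
      i ≫ p = f ∧
      DGcoAlgConn.cofibrations K i ∧
      DGcoAlgConn.weakEquivalences K p ∧ DGcoAlgConn.fibrations K p := by
  obtain ⟨i, h₁, h₂⟩ := DGcoAlgConn.exists_cofreeProduct_lift C.reduced.cone f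
    C.toCone
  exact ⟨_, i, DGcoAlgConn.cofreeProductFst D _, DGcoAlgConn.cofreeProductSnd D _,
    DGcoAlgConn.cofreeProduct_isLimit D _, h₁, DGcoAlgConn.cofibration_of_proj h₂,
    DGcoAlgConn.cofreeProductFst_quasiIso D _ (DGVct.contractible_cone _),
    DGcoAlgConn.cofreeProductFst_cone_fibration D _⟩
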